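/- **Setting.** Let $s\in\{\tfrac12,1,\tfrac32,\dots\}$ and $n,m\ge 1$ be given. On $\mathbb C^{2s+1}$ with its basis $|s,p\rangle$, $-s\le p\le s$, and spin operators $S_x,S_y,S_z$, let $\mathcal A(s)$ be the group of all $$U_{\theta,\phi,z,\gamma}=e^{i\gamma}e^{i\theta(S_y\cos\phi-S_x\sin\phi)}e^{izS_z},\qquad \theta\in[0,\pi],\ \phi,z,\gamma\in[0,2\pi),$$ let $\mathcal L(s)=\{V|s,-s\rangle: V\in\mathcal A(s)\}$ be the set of spin-$s$ coherent states, and $|s,\theta,\phi\rangle=U_{\theta,\phi,0,0}|s,-s\rangle$. Let $P_{ns}$ be the projector of $(\mathbb C^{2s+1})^{\otimes n}$ onto the span of the $2ns+1$ states $|ns,p\rangle$ of total spin $ns$ (those obtained from $|s,-s\rangle^{\otimes n}$ with the collective raising operator), and $\rho_0^n=P_{ns}/(2ns+1)$. For a finite $\mathcal W\subset\mathcal L(s)$ with a probability distribution $(p_\varphi)_{\varphi\in\mathcal W}$ put $\rho_{\mathcal W}^n=\sum_{\varphi\in\mathcal W}p_\varphi|\varphi\rangle\langle\varphi|^{\otimes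 n}$. For $0\le\epsilon<1$, the weighted set reproduces the $n$-copy resolution of the identity up to $\epsilon$ if $(1-\epsilon)\rho_0^n\le\rho_{\mathcal W}^n\le(1+\epsilon)\rho_0^n$ (so $\rho^n_{\mathcal W}=\rho^n_0$ if $\epsilon=0$). *Cloning map.* $\mathcal R=\mathcal R_{n,m}^{\mathcal L(s)}$ is any map (not necessarily linear, positive, or continuous) that sends $|\psi\rangle\langle\psi|^{\otimes n}$, $\psi\in\mathcal L(s)$, to density operators on $(\mathbb C^{2s+1})^{\otimes m}$ and, if $\epsilon>0$, also sends every density operator on the symmetric subspace of $(\mathbb C^{2s+1})^{\otimes n}$ to a density operator. Its worst case global fidelity is $$F_{\rm wc}(\mathcal R)=\inf_{\psi\in\mathcal L(s)}F\big(\mathcal R(|\psi\rangle\langle\psi|^{\otimes n}),|\psi\rangle\langle\psi|^{\otimes m}\big),\qquad F(\rho,\sigma)=(\operatorname{Tr}|\sqrt\rho\sqrt\sigma|)^2 .$$ *No-signalling.* Alice and Bob share the maximally entangled state of two copies of $(\mathbb C^{2s+1})^{\otimes n}$, conditioned on Alice having found $P_{ns}$ and Bob having found $P_{ns}^{\mathsf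 T}$. Bob chooses $V\in\mathcal A(s)$ and measures the effects $E_\varphi=\frac{2ns+1}{1+\epsilon}\,p_\varphi\big((V|\varphi\rangle\langle\varphi|V^\dagger)^{\otimes n}\big)^{\mathsf T}$, $\varphi\in\mathcal W$, and $E_{\rm res}=P_{ns}^{\mathsf T}-\sum_\varphi E_\varphi$; Alice applies $\mathcal R$ to her conditional state. $\mathcal R$ is *no-signalling* for $(\mathcal W,p,\epsilon)$ if Alice's output, averaged over Bob's outcomes, does not depend on $V$. **Theorem.** 1. If $(\mathcal W,p)$ reproduces the $n$-copy resolution of the identity up to $\epsilon\in[0,1)$, then every cloning map $\mathcal R$ that is no-signalling for $(\mathcal W,p,\epsilon)$ satisfies $$F_{\rm wc}(\mathcal R)\le\Big(\frac{1+\epsilon}{1-\epsilon}\Big)^2\frac{|\mathcal W|}{2ms+1}.$$ 2. For all $s$ and $n$ there is a quadrature rule $\int_{-1}^1f(x)\,dx=\sum_jw_jf(\cos\theta_j)$, exact for all polynomials $f$ of degree at most $2ns$, with finitely many $\theta_j\in[0,\pi)$ and weights $w_j>0$, such that the set $\mathcal W$ of the states $|s,\theta_j,\phi_k\rangle$, $\phi_k=\frac{2\pi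 k}{2ns+1}$, $0\le k\le 2ns$, where the pair $(j,k)$ has probability $\frac{w_j}{2(2ns+1)}$ (probabilities of coinciding states being added), satisfies $\rho_{\mathcal W}^n=\rho_0^n$ and $|\mathcal W|\le\frac{(2ns+1)^2}{2}$. Hence, for every $m\ge1$, every cloning map $\mathcal R$ that is no-signalling for this $(\mathcal W,p)$ with $\epsilon=0$ satisfies $$F_{\rm wc}(\mathcal R)\le\frac{(2ns+1)^2}{2(2ms+1)}.$$ -/

import Mathlib

open scoped ComplexOrder MatrixOrder

noncomputable section

namespace SpinCloning

/-! ### Spin operators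

The spin is `s = t / 2` with `t : ℕ`; the basis vector `k : Fin (t + 1)` is `|s, p⟩` with
`p = k - s`, so `k = 0` is `|s, -s⟩`. -/

/-- A square matrix over the index set of `n` spins `s = t / 2`: an operator on
`(ℂ^(2s+1))^{⊗ n}`, written in the product basis. -/
abbrev Op (t n : ℕ) : Type := Matrix (Fin n → Fin (t + 1)) (Fin n → Fin (t + 1)) ℂ

/-- `S_z |s, p⟩ = p |s, p⟩`. -/
def spinZ (t : ℕ) : Matrix (Fin (t + 1)) (Fin (t + 1)) ℂ :=
  Matrix.diagonal fun k => (((k : ℕ) : ℂ) - (t : ℂ) / 2)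

/-- The raising operator `S_+ |s, p⟩ = √((s - p) (s + p + 1)) |s, p + 1⟩`. -/
def spinUp (t : ℕ) : Matrix (Fin (t + 1)) (Fin (t + 1)) ℂ := fun i j =>
  if (i : ℕ) = (j : ℕ) + 1 then
    ((Real.sqrt (((t : ℝ) - ((j : ℕ) : ℝ)) * (((j : ℕ) : ℝ) + 1)) : ℝ) : ℂ)
  else 0

/-- `S_x = (S_+ + S_-) / 2`, with `S_- = (S_+)†`. -/
def spinX (t : ℕ) : Matrix (Fin (t + 1)) (Fin (t + 1)) ℂ :=
  (1 / 2 : ℂ) • (spinUp t + (spinUp t).conjTranspose)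

/-- `S_y = (S_+ - S_-) / (2 i)`. -/
def spinY (t : ℕ) : Matrix (Fin (t + 1)) (Fin (t + 1)) ℂ :=
  (1 / (2 * Complex.I) : ℂ) • (spinUp t - (spinUp t).conjTranspose)

/-- The lowest weight vector `|s, -s⟩`. -/
def lowest (t : ℕ) : Fin (t + 1) → ℂ := Pi.single 0 1

/-- `U_{θ,φ,z,γ} = e^{iγ} exp(iθ (S_y cos φ - S_x sin φ)) exp(i z S_z)`. -/
def rotation (t : ℕ) (θ φ z γ : ℝ) : Matrix (Fin (t + 1)) (Fin (t + 1)) ℂ :=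
  Complex.exp (Complex.I * (γ : ℂ)) •
    (NormedSpace.exp ((Complex.I * (θ : ℂ)) •
        ((Real.cos φ : ℂ) • spinY t - (Real.sin φ : ℂ) • spinX t)) *
      NormedSpace.exp ((Complex.I * (z : ℂ)) • spinZ t))

/-- The group `𝒜(s)` of all `U_{θ,φ,z,γ}`. -/
def rotationGroup (t : ℕ) : Set (Matrix (Fin (t + 1)) (Fin (t + 1)) ℂ) :=
  {V | ∃ θ ∈ Set.Icc 0 Real.pi, ∃ φ ∈ Set.Ico 0 (2 * Real.pi),
    ∃ z ∈ Set.Ico 0 (2 * Real.pi), ∃ γ ∈ Set.Ico 0 (2 * Real.pi), V = rotation t θ φ z γ}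

/-- The set `ℒ(s)` of spin coherent states `U_{θ,φ,z,γ} |s, -s⟩`. -/
def coherentStates (t : ℕ) : Set (Fin (t + 1) → ℂ) :=
  {ψ | ∃ V ∈ rotationGroup t, ψ = Matrix.mulVec V (lowest t)}

/-- `|s, θ, φ⟩ = |s, θ, φ, 0, 0⟩`. -/
def coherent (t : ℕ) (θ φ : ℝ) : Fin (t + 1) → ℂ :=
  Matrix.mulVec (rotation t θ φ 0 0) (lowest t)

/-! ### `n` copies -/

/-- The vector `ψ^{⊗ n}`. -/
def tensorVec {t : ℕ} (n : ℕ) (ψ : Fin (t + 1) → ℂ) : (Fin n → Fin (t + 1)) → ℂ :=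
  fun x => ∏ l, ψ (x l)

/-- The operator `|v⟩⟨v|`. -/
def ketbra {ι : Type*} (v : ι → ℂ) : Matrix ι ι ℂ := Matrix.vecMulVec v (star v)

/-- The operator `|ψ⟩⟨ψ|^{⊗ n}`. -/
def copies {t : ℕ} (n : ℕ) (ψ : Fin (t + 1) → ℂ) : Op t n := ketbra (tensorVec n ψ)

/-- The collective raising operator `S'_+ = ∑ l, S_{+,l}` on `n` spins. -/
def totalUp (t n : ℕ) : Op t n := fun x y =>
  ∑ l, if ∀ l', l' ≠ l → x l' = y l' then spinUp t (x l) (y l) else 0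

/-- The state `|ns, p⟩`, `p = k - ns`, of total spin `J = ns`, obtained from
`|ns, -ns⟩ = |s, -s⟩^{⊗ n}` by raising `k` times:
`|J, k - J⟩ = √((2J - k)! / (k! (2J)!)) (S'_+)^k |J, -J⟩`, with `2J = n t`. -/
def totalSpinState (t n k : ℕ) : (Fin n → Fin (t + 1)) → ℂ :=
  ((Real.sqrt (((n * t - k).factorial : ℝ) /
      ((k.factorial : ℝ) * ((n * t).factorial : ℝ))) : ℝ) : ℂ) •
    Matrix.mulVec (totalUp t n ^ k) (tensorVec n (lowest t))

/-- `P_{ns} = ∑_{p = -ns}^{ns} |ns, p⟩⟨ns, p|`. -/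
def spinProj (t n : ℕ) : Op t n :=
  ∑ k ∈ Finset.range (n * t + 1), ketbra (totalSpinState t n k)

/-- `ρ₀^n = P_{ns} / (2ns + 1)`. -/
def rhoZero (t n : ℕ) : Op t n := (1 / ((n : ℂ) * (t : ℂ) + 1)) • spinProj t n

/-- `ρ_𝒲^n = ∑_{φ ∈ 𝒲} p_φ |φ⟩⟨φ|^{⊗ n}`. -/
def rhoW {t : ℕ} (n : ℕ) (W : Finset (Fin (t + 1) → ℂ)) (p : (Fin (t + 1) → ℂ) → ℝ) : Op t n :=
  ∑ φ ∈ W, (p φ : ℂ) • copies n φ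

/-- `(𝒲, p)` is a finite set of spin coherent states with a probability distribution. -/
structure IsWeightedSet {t : ℕ} (W : Finset (Fin (t + 1) → ℂ)) (p : (Fin (t + 1) → ℂ) → ℝ) :
    Prop where
  coherent : ∀ φ ∈ W, φ ∈ coherentStates t
  nonneg : ∀ φ ∈ W, 0 ≤ p φ
  sum_eq_one : ∑ φ ∈ W, p φ = 1

/-- `(1 - ε) ρ₀^n ≤ ρ_𝒲^n ≤ (1 + ε) ρ₀^n` in the positive semidefinite order; for `ε = 0` this is
`ρ_𝒲^n = ρ₀^n`. -/
def IsApproxDesign {t : ℕ} (n : ℕ) (ε : ℝ) (W : Finset (Fin (t + 1) → ℂ))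
    (p : (Fin (t + 1) → ℂ) → ℝ) : Prop :=
  ((1 - ε : ℝ) : ℂ) • rhoZero t n ≤ rhoW n W p ∧ rhoW n W p ≤ ((1 + ε : ℝ) : ℂ) • rhoZero t n

/-! ### States and fidelity -/

/-- Density operators. -/
def IsState {ι : Type*} [Fintype ι] (ρ : Matrix ι ι ℂ) : Prop :=
  ρ.PosSemidef ∧ ρ.trace = 1

/-- The (possibly mixed) state `ρ` lives on the symmetric subspace: permuting the tensor factors
of its kets leaves it unchanged. -/
def IsSymmetricState {t n : ℕ} (ρ : Op t n) : Prop :=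
  IsState ρ ∧ ∀ (π : Equiv.Perm (Fin n)) (x y), ρ (x ∘ π) y = ρ x y

/-- The Uhlmann fidelity `F(ρ, σ) = (Tr |√ρ √σ|)²`. -/
def fidelity {ι : Type*} [Fintype ι] [DecidableEq ι] (ρ σ : Matrix ι ι ℂ) : ℝ :=
  (Matrix.trace (CFC.abs (CFC.sqrt ρ * CFC.sqrt σ))).re ^ 2

/-- The worst case global cloning fidelity
`F_wc(ℛ) = inf_{ψ ∈ ℒ(s)} F(ℛ(|ψ⟩⟨ψ|^{⊗ n}), |ψ⟩⟨ψ|^{⊗ m})`. -/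
def worstFidelity {t n m : ℕ} (R : Op t n → Op t m) : ℝ :=
  ⨅ ψ : coherentStates t, fidelity (R (copies n ψ.1)) (copies m ψ.1)

/-! ### The remote state preparation protocol and the no-signalling principle -/

/-- The maximally entangled vector `|A|^{-1/2} ∑ i, |i⟩_A |i⟩_B`. -/
def maxEntangled (ι : Type*) [Fintype ι] [DecidableEq ι] : ι × ι → ℂ := fun x =>
  if x.1 = x.2 then ((1 / Real.sqrt (Fintype.card ι) : ℝ) : ℂ) else 0

/-- The partial trace `Tr_B`. -/
def traceB {α β : Type*} [Fintype β] (M : Matrix (α × β) (α × β) ℂ) : Matrix α α ℂ :=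
  fun a a' => ∑ b, M (a, b) (a', b)

/-- The unnormalised state on `AB` after Alice found `P_A = P_{ns}` and Bob found
`P_B = P_{ns}ᵀ` on the shared state. The operator `L_B = (2ns+1)^{-1/2} 1` being scalar, the shared
state `N (1 ⊗ L_B) |Ψ^n⟩` is the maximally entangled one. -/
def afterSuccess (t n : ℕ) :
    Matrix ((Fin n → Fin (t + 1)) × (Fin n → Fin (t + 1)))
      ((Fin n → Fin (t + 1)) × (Fin n → Fin (t + 1))) ℂ :=
  ketbra (Matrix.mulVec (Matrix.kronecker (spinProj t n) (spinProj t n).transpose)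
    (maxEntangled (Fin n → Fin (t + 1))))

/-- The normalised state on `AB` conditioned on success. -/
def sharedState (t n : ℕ) :
    Matrix ((Fin n → Fin (t + 1)) × (Fin n → Fin (t + 1)))
      ((Fin n → Fin (t + 1)) × (Fin n → Fin (t + 1))) ℂ :=
  (afterSuccess t n).trace⁻¹ • afterSuccess t n

/-- Alice's unnormalised state when Bob's measurement gives the outcome with effect `E`:
`Tr_B ((1 ⊗ E) Ψ)`. -/
def aliceUnnormalized {t n : ℕ} (E : Op t n) : Op t n :=
  traceB (Matrix.kronecker (1 : Op t n) E * sharedState t n)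

/-- The probability of Bob's outcome with effect `E`. -/
def outcomeProb {t n : ℕ} (E : Op t n) : ℝ := (aliceUnnormalized E).trace.re

/-- Alice's state conditioned on Bob's outcome with effect `E`. -/
def aliceState {t n : ℕ} (E : Op t n) : Op t n :=
  ((outcomeProb E)⁻¹ : ℂ) • aliceUnnormalized E

/-- Bob's effect for the outcome `φ` when he has chosen the rotation `V`:
`(1 - p_res) p_φ (L_B⁻¹)† ((V|φ⟩⟨φ|V†)^{⊗ n})ᵀ L_B⁻¹`, where `1 - p_res = 1 / (1 + ε)` and
`L_B⁻¹ = √(2ns+1)`. -/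
def bobEffect {t : ℕ} (n : ℕ) (ε : ℝ) (p : (Fin (t + 1) → ℂ) → ℝ)
    (V : Matrix (Fin (t + 1)) (Fin (t + 1)) ℂ) (φ : Fin (t + 1) → ℂ) : Op t n :=
  (((1 / (1 + ε)) * p φ * ((n : ℝ) * (t : ℝ) + 1) : ℝ) : ℂ) •
    (copies n (Matrix.mulVec V φ)).transpose

/-- Bob's residual effect `P_B - ∑_φ E_φ`, which vanishes for an exact design and `ε = 0`. -/
def bobResidual {t : ℕ} (n : ℕ) (ε : ℝ) (W : Finset (Fin (t + 1) → ℂ))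
    (p : (Fin (t + 1) → ℂ) → ℝ) (V : Matrix (Fin (t + 1)) (Fin (t + 1)) ℂ) : Op t n :=
  (spinProj t n).transpose - ∑ φ ∈ W, bobEffect n ε p V φ

/-- The state Alice holds after she has applied the cloning oracle `R` to her system and before
she learns Bob's outcome, when Bob has chosen `V`. -/
def aliceOutput {t n m : ℕ} (ε : ℝ) (W : Finset (Fin (t + 1) → ℂ))
    (p : (Fin (t + 1) → ℂ) → ℝ) (R : Op t n → Op t m)
    (V : Matrix (Fin (t + 1)) (Fin (t + 1)) ℂ) : Op t m :=
  (∑ φ ∈ W, (outcomeProb (bobEffect n ε p V φ) : ℂ) • R (aliceState (bobEffect n ε p V φ))) +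
    (outcomeProb (bobResidual n ε W p V) : ℂ) • R (aliceState (bobResidual n ε W p V))

/-- The no-signalling principle for the protocol: Alice's output does not depend on the rotation
that Bob has chosen. -/
def NoSignalling {t n m : ℕ} (ε : ℝ) (W : Finset (Fin (t + 1) → ℂ))
    (p : (Fin (t + 1) → ℂ) → ℝ) (R : Op t n → Op t m) : Prop :=
  ∀ V ∈ rotationGroup t, ∀ V' ∈ rotationGroup t, aliceOutput ε W p R V = aliceOutput ε W p R V'

/-- What is asked of a cloning map `R` (conditioned on success): it sends `n` copies of a spin
coherent state to a state of `m` spins and, when the protocol is only approximate (`0 < ε`), it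
sends every state on the symmetric subspace of `n` spins to a state of `m` spins. No linearity,
positivity or continuity is required. -/
structure IsCloningMap {t n m : ℕ} (ε : ℝ) (R : Op t n → Op t m) : Prop where
  onCoherent : ∀ ψ ∈ coherentStates t, IsState (R (copies n ψ))
  onSymmetric : 0 < ε → ∀ ρ : Op t n, IsSymmetricState ρ → IsState (R ρ)

/-! ### The quadrature construction -/

/-- The quadrature rule with nodes `x = cos θ`, `θ ∈ Θ ⊂ [0, π)`, and positive weights `w θ` on
`[-1, 1]` is exact for polynomials of degree at most `N`. -/
structure IsQuadrature (N : ℕ) (Θ : Finset ℝ) (w : ℝ → ℝ) : Prop where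
  mem : ∀ θ ∈ Θ, θ ∈ Set.Ico 0 Real.pi
  pos : ∀ θ ∈ Θ, 0 < w θ
  exact : ∀ f : Polynomial ℝ, f.natDegree ≤ N →
    ∫ x in (-1 : ℝ)..1, f.eval x = ∑ θ ∈ Θ, w θ * f.eval (Real.cos θ)

/-- The angles `φ_k = 2πk / (2ns+1)`, `N = 2ns`. -/
def gridAngle (N : ℕ) (k : Fin (N + 1)) : ℝ := 2 * Real.pi * (k : ℕ) / ((N : ℝ) + 1)

open Classical in
/-- The set of the states `|s, θ, φ_k⟩`, `θ ∈ Θ`, `0 ≤ k ≤ N`. -/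
def gridSet (t N : ℕ) (Θ : Finset ℝ) : Finset (Fin (t + 1) → ℂ) :=
  (Θ ×ˢ (Finset.univ : Finset (Fin (N + 1)))).image fun a => coherent t a.1 (gridAngle N a.2)

open Classical in
/-- The probability of `ψ` when `(θ, φ_k)` has probability `(w θ / 2) (1 / (N + 1))`; coinciding
states `|s, θ, φ_k⟩` have their probabilities added. -/
def gridWeight (t N : ℕ) (Θ : Finset ℝ) (w : ℝ → ℝ) (ψ : Fin (t + 1) → ℂ) : ℝ :=
  ∑ a ∈ Θ ×ˢ (Finset.univ : Finset (Fin (N + 1))),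
    if coherent t a.1 (gridAngle N a.2) = ψ then w a.1 / 2 * (1 / ((N : ℝ) + 1)) else 0

end SpinCloning

end

/-! Coherent states are, up to a phase, the symmetric powers `cvec t a b` of a unit qubit vector
`(a, b)`, and rotations act on `(a, b)` as `SU(2)`. Hence the rotation group is transitive on the
operators `copies n ψ`. Moreover `n` copies of a spin-`t/2` coherent state form one coherent state
of spin `n t / 2`, embedded by `spinIsometry` (`tensorVec_cvec_eq`).

Upper bound (`worstFidelity_le_card`). By no-signalling, Alice's averaged output is a single state
`σ`. Given `φ ∈ W` and any coherent `ψ`, Bob may choose `V` turning `φ` into `ψ`. Then `σ` dominates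
`p φ / (1 + ε)` times the clone of `ψ`, so `Tr (σ |ψ⟩⟨ψ|^{⊗ m}) ≥ p φ F / (1 + ε)` with `F` the
worst case fidelity. Averaging `ψ` over an exact `m`-copy design bounds the right side by `Tr (σ
ρ₀^m) ≤ 1 / (m t + 1)`. Summing over `φ ∈ W` gives `F ≤ (1 + ε) |W| / (m t + 1)`, which is stronger
than the stated bound. Fidelity with a pure state is an expectation value (`fidelity_ketbra`), so
only positivity and traces enter.

Design (`exists_design`). With `N = n t`, the sum over the `N + 1` azimuths removes the off-diagonal
entries of the averaged coherent state. The diagonal entries are integrals over `[-1, 1]` of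
polynomials of degree `N` in `cos θ`, reproduced by the quadrature. Gauss quadrature (`N` odd), or
Gauss-Radau with the node `θ = 0` (`N` even), where all azimuths give the same state, keeps the set
within `(N + 1)² / 2`. -/

namespace SpinCloning

open Matrix

/-! ### Matrix exponentials and linear differential equations -/

section Exp

open scoped Matrix.Norms.Operator

/-- A solution of `u' = B u` is `u θ = exp (θ B) u 0`. -/
theorem exp_mulVec_of_hasDerivAt {ι : Type*} [Fintype ι] [DecidableEq ι] (B : Matrix ι ι ℂ)
    (u : ℝ → ι → ℂ) (hu : ∀ θ, HasDerivAt u (B *ᵥ u θ) θ) (θ : ℝ) :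
    NormedSpace.exp ((θ : ℂ) • B) *ᵥ u 0 = u θ := by
  have hE : ∀ θ : ℝ, HasDerivAt (fun θ : ℝ => NormedSpace.exp (θ • (-B)))
      (NormedSpace.exp (θ • (-B)) * (-B)) θ := fun θ => hasDerivAt_exp_smul_const (𝕂 := ℝ) (-B) θ
  have hent : ∀ (θ : ℝ) i j, HasDerivAt (fun θ : ℝ => NormedSpace.exp (θ • (-B)) i j)
      ((NormedSpace.exp (θ • (-B)) * (-B)) i j) θ := fun θ i j =>
    (LinearMap.toContinuousLinearMap
      (Matrix.entryLinearMap ℝ ℂ i j)).hasFDerivAt.comp_hasDerivAt θ (hE θ)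
  -- Integrating factor: `exp (-θ B) u θ` is constant.
  have hg : ∀ θ : ℝ, HasDerivAt (fun θ : ℝ => NormedSpace.exp (θ • (-B)) *ᵥ u θ) 0 θ := by
    intro θ
    rw [hasDerivAt_pi]
    intro i
    have h := HasDerivAt.fun_sum (u := Finset.univ) fun j _ =>
      (hent θ i j).mul (hasDerivAt_pi.1 (hu θ) j)
    have hz : (NormedSpace.exp (θ • (-B)) * (-B)) *ᵥ u θ +
        NormedSpace.exp (θ • (-B)) *ᵥ (B *ᵥ u θ) = 0 := by
      rw [Matrix.mulVec_mulVec, mul_neg, Matrix.neg_mulVec, neg_add_cancel]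
    refine h.congr_deriv ?_
    rw [← hz, Pi.add_apply, Finset.sum_add_distrib]
    rfl
  have hc : NormedSpace.exp (θ • (-B)) *ᵥ u θ = NormedSpace.exp ((0 : ℝ) • (-B)) *ᵥ u 0 :=
    is_const_of_deriv_eq_zero (fun x => (hg x).differentiableAt) (fun x => (hg x).deriv) θ 0
  rw [zero_smul, NormedSpace.exp_zero, Matrix.one_mulVec] at hc
  have hs : (θ : ℂ) • B = θ • B := by ext i j; simp
  rw [← hc, Matrix.mulVec_mulVec, hs, ← Matrix.exp_add_of_commute, smul_neg, add_neg_cancel,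
    NormedSpace.exp_zero, Matrix.one_mulVec]
  rw [smul_neg]
  exact (Commute.refl _).neg_right

theorem exp_mem_unitary_of_conjTranspose_eq_neg {ι : Type*} [Fintype ι] [DecidableEq ι]
    {B : Matrix ι ι ℂ} (hB : Bᴴ = -B) : (NormedSpace.exp B)ᴴ * NormedSpace.exp B = 1 := by
  rw [← Matrix.exp_conjTranspose, hB, ← Matrix.exp_add_of_commute, neg_add_cancel,
    NormedSpace.exp_zero]
  exact (Commute.refl _).neg_left

end Exp

/-! ### Coherent states as symmetric powers of qubit vectors -/

/-- The (unnormalised) vector `∑ k, √(t choose k) a^(t-k) b^k |k⟩`, the spin-`t/2` symmetric power of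
`a |↓⟩ + b |↑⟩`. -/
noncomputable def cvec (t : ℕ) (a b : ℂ) : Fin (t + 1) → ℂ := fun k =>
  ((Real.sqrt (t.choose k) : ℝ) : ℂ) * (a ^ (t - (k : ℕ)) * b ^ (k : ℕ))

theorem lowest_eq_cvec (t : ℕ) : lowest t = cvec t 1 0 := by
  ext k
  refine Fin.cases ?_ (fun i => ?_) k
  · simp [lowest, cvec]
  · simp [lowest, cvec]

theorem cvec_smul (t : ℕ) (ζ a b : ℂ) : cvec t (ζ * a) (ζ * b) = ζ ^ t • cvec t a b := by
  ext k
  have hk : t - (k : ℕ) + k = t := Nat.sub_add_cancel (Nat.lt_succ_iff.1 k.2)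
  have : ζ ^ t = ζ ^ (t - (k : ℕ)) * ζ ^ (k : ℕ) := by rw [← pow_add, hk]
  simp only [cvec, Pi.smul_apply, smul_eq_mul, mul_pow, this]
  ring

/-- On the monomials `a^(t-k) b^k` the raising operator is `a ∂/∂b`, because `√((t-j)(j+1)) √(t
choose j) = (j+1) √(t choose (j+1))`. At `k = 0` the truncated exponent is harmless, since the
factor `k` vanishes. -/
theorem spinUp_mulVec_cvec (t : ℕ) (a b : ℂ) (k : Fin (t + 1)) :
    (spinUp t *ᵥ cvec t a b) k =
      (Real.sqrt (t.choose k) : ℂ) * (k * (a ^ (t - (k : ℕ) + 1) * b ^ ((k : ℕ) - 1))) := by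
  rw [Matrix.mulVec, dotProduct]
  rcases k with ⟨k, hk⟩
  rcases k with _ | j
  · simp [spinUp]
  · rw [Finset.sum_eq_single (⟨j, by omega⟩ : Fin (t + 1))]
    · have hj : j ≤ t := by omega
      have h1 : Real.sqrt (((t : ℝ) - j) * ((j : ℝ) + 1)) * Real.sqrt (t.choose j) =
          Real.sqrt (t.choose (j + 1)) * ((j : ℝ) + 1) := by
        have hc : ((t.choose (j + 1) : ℕ) : ℝ) * ((j : ℝ) + 1) = t.choose j * ((t : ℝ) - j) := by
          have := Nat.choose_succ_right_eq t j
          rw [← Nat.cast_sub hj]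
          exact_mod_cast this
        have h0 : (0 : ℝ) ≤ (j : ℝ) + 1 := by positivity
        rw [← Real.sqrt_mul' _ (Nat.cast_nonneg _)]
        conv_rhs => rw [← Real.sqrt_mul_self h0, ← Real.sqrt_mul (Nat.cast_nonneg _)]
        congr 1
        linear_combination -((j : ℝ) + 1) * hc
      have h1' : (Real.sqrt (((t : ℝ) - j) * ((j : ℝ) + 1)) : ℂ) * (Real.sqrt (t.choose j) : ℂ) =
          (Real.sqrt (t.choose (j + 1)) : ℂ) * ((j : ℂ) + 1) := by exact_mod_cast h1
      have he : t - (j + 1) + 1 = t - j := by omega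
      simp only [spinUp, if_true, cvec, he, Nat.add_sub_cancel]
      push_cast
      linear_combination (a ^ (t - j) * b ^ j) * h1'
    · intro i _ hi
      have : ¬ (j = (i : ℕ)) := fun h => hi (Fin.ext h.symm)
      simp [spinUp, this]
    · simp

/-- The mirror image: lowering is `b ∂/∂a`, and the factor `t - k` vanishes at the top weight. -/
theorem spinDown_mulVec_cvec (t : ℕ) (a b : ℂ) (k : Fin (t + 1)) :
    ((spinUp t)ᴴ *ᵥ cvec t a b) k = (Real.sqrt (t.choose k) : ℂ) *
      (((t - k : ℕ) : ℂ) * (a ^ (t - (k : ℕ) - 1) * b ^ ((k : ℕ) + 1))) := by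
  rw [Matrix.mulVec, dotProduct]
  rcases k with ⟨j, hk⟩
  rcases Nat.lt_succ_iff_lt_or_eq.1 hk with hj | rfl
  · rw [Finset.sum_eq_single (⟨j + 1, by omega⟩ : Fin (t + 1))]
    · have h1 : Real.sqrt (((t : ℝ) - j) * ((j : ℝ) + 1)) * Real.sqrt (t.choose (j + 1)) =
          Real.sqrt (t.choose j) * ((t - j : ℕ) : ℝ) := by
        have hc : ((t.choose (j + 1) : ℕ) : ℝ) * ((j : ℝ) + 1) =
            t.choose j * ((t - j : ℕ) : ℝ) := by
          exact_mod_cast Nat.choose_succ_right_eq t j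
        have h0 : (0 : ℝ) ≤ ((t - j : ℕ) : ℝ) := by positivity
        rw [← Nat.cast_sub hj.le, ← Real.sqrt_mul' _ (Nat.cast_nonneg _)]
        conv_rhs => rw [← Real.sqrt_mul_self h0, ← Real.sqrt_mul (Nat.cast_nonneg _)]
        congr 1
        linear_combination ((t - j : ℕ) : ℝ) * hc
      have h1' : (Real.sqrt (((t : ℝ) - j) * ((j : ℝ) + 1)) : ℂ) *
          (Real.sqrt (t.choose (j + 1)) : ℂ) =
          (Real.sqrt (t.choose j) : ℂ) * ((t - j : ℕ) : ℂ) := by exact_mod_cast h1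
      have he : t - (j + 1) = t - j - 1 := by omega
      simp only [spinUp, if_true, cvec, he, Matrix.conjTranspose_apply, Complex.star_def,
        Complex.conj_ofReal]
      linear_combination (a ^ (t - j - 1) * b ^ (j + 1)) * h1'
    · intro i _ hi
      have : ¬ ((i : ℕ) = j + 1) := fun h => hi (Fin.ext h)
      simp [spinUp, this]
    · simp
  · have : ∀ i : Fin (j + 1), ¬ ((i : ℕ) = j + 1) := fun i => by omega
    simp [spinUp, this]

/-- The generator `i (S_y cos φ - S_x sin φ)` in terms of `S_±`. -/
theorem generator_eq (t : ℕ) (φ : ℝ) :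
    Complex.I • ((Real.cos φ : ℂ) • spinY t - (Real.sin φ : ℂ) • spinX t) =
      (Complex.exp (-(φ * Complex.I)) / 2) • spinUp t -
        (Complex.exp (φ * Complex.I) / 2) • (spinUp t)ᴴ := by
  have h1 : Complex.exp (-(φ * Complex.I)) = Complex.cos φ - Complex.sin φ * Complex.I := by
    rw [← neg_mul, Complex.exp_mul_I, Complex.cos_neg, Complex.sin_neg]; ring
  rw [h1, Complex.exp_mul_I]
  ext i j
  simp only [spinX, spinY, Matrix.smul_apply, Matrix.sub_apply, Matrix.add_apply, smul_eq_mul,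
    Complex.ofReal_cos, Complex.ofReal_sin]
  have hI : Complex.I * (1 / (2 * Complex.I)) = 1 / 2 := by
    field_simp
  linear_combination (Complex.cos φ * (spinUp t i j - (spinUp t)ᴴ i j)) * hI

theorem hasDerivAt_cvec (t : ℕ) {a b : ℝ → ℂ} {a' b' : ℂ} {θ : ℝ} (ha : HasDerivAt a a' θ)
    (hb : HasDerivAt b b' θ) (k : Fin (t + 1)) :
    HasDerivAt (fun θ => cvec t (a θ) (b θ) k) ((Real.sqrt (t.choose k) : ℂ) *
      ((((t - k : ℕ) : ℂ) * a θ ^ (t - (k : ℕ) - 1) * a') * b θ ^ (k : ℕ) +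
        a θ ^ (t - (k : ℕ)) * ((k : ℂ) * b θ ^ ((k : ℕ) - 1) * b'))) θ :=
  ((ha.pow (t - (k : ℕ))).mul (hb.pow (k : ℕ))).const_mul _

/-- Since `S_±` are the derivations `a ∂/∂b` and `b ∂/∂a`, the generator acts on `cvec t a b` by
moving `(a, b)` along a linear flow in `ℂ²`. That flow is the half-angle rotation on the right, so
both sides solve the same linear equation in `θ`. -/
theorem exp_generator_mulVec_cvec (t : ℕ) (θ φ : ℝ) (a b : ℂ) :
    NormedSpace.exp ((Complex.I * (θ : ℂ)) •
        ((Real.cos φ : ℂ) • spinY t - (Real.sin φ : ℂ) • spinX t)) *ᵥ cvec t a b =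
      cvec t (a * Real.cos (θ / 2) - b * (Complex.exp (φ * Complex.I) * Real.sin (θ / 2)))
        (a * (Complex.exp (-(φ * Complex.I)) * Real.sin (θ / 2)) + b * Real.cos (θ / 2)) := by
  have hee : Complex.exp (-(φ * Complex.I)) * Complex.exp (φ * Complex.I) = 1 := by
    rw [← Complex.exp_add, neg_add_cancel, Complex.exp_zero]
  set e := Complex.exp (φ * Complex.I)
  set e' := Complex.exp (-(φ * Complex.I))
  set u : ℝ → Fin (t + 1) → ℂ := fun θ =>
    cvec t (a * Real.cos (θ / 2) - b * (e * Real.sin (θ / 2)))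
      (a * (e' * Real.sin (θ / 2)) + b * Real.cos (θ / 2)) with hu
  have h0 : u 0 = cvec t a b := by simp [hu]
  rw [mul_comm, mul_smul, generator_eq, ← h0]
  refine exp_mulVec_of_hasDerivAt _ u (fun θ => ?_) θ
  have hc : HasDerivAt (fun θ : ℝ => ((Real.cos (θ / 2) : ℝ) : ℂ))
      (((-Real.sin (θ / 2) * (1 / 2) : ℝ) : ℂ)) θ :=
    (((hasDerivAt_id θ).div_const 2).cos).ofReal_comp
  have hs : HasDerivAt (fun θ : ℝ => ((Real.sin (θ / 2) : ℝ) : ℂ))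
      (((Real.cos (θ / 2) * (1 / 2) : ℝ) : ℂ)) θ :=
    (((hasDerivAt_id θ).div_const 2).sin).ofReal_comp
  rw [hasDerivAt_pi]
  intro k
  have h := hasDerivAt_cvec t ((hc.const_mul a).fun_sub ((hs.const_mul e).const_mul b))
    (((hs.const_mul e').const_mul a).fun_add (hc.const_mul b)) k
  refine h.congr_deriv ?_
  rw [Matrix.sub_mulVec, Matrix.smul_mulVec, Matrix.smul_mulVec, Pi.sub_apply, Pi.smul_apply,
    Pi.smul_apply, hu, spinUp_mulVec_cvec, spinDown_mulVec_cvec]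
  simp only [smul_eq_mul, pow_succ]
  push_cast
  set c := Complex.cos (θ / 2)
  set s := Complex.sin (θ / 2)
  -- The flow on the parameters, `a' = -(e/2) b` and `b' = (e'/2) a`.
  have e1 : a * (-s * (1 / 2)) - b * (e * (c * (1 / 2))) = -(e / 2) * (a * (e' * s) + b * c) := by
    linear_combination (a * s / 2) * hee
  have e2 : a * (e' * (c * (1 / 2))) + b * (-s * (1 / 2)) = (e' / 2) * (a * c - b * (e * s)) := by
    linear_combination (b * s / 2) * hee
  rw [e1, e2]
  ring

theorem exp_spinZ_mulVec_cvec (t : ℕ) (z : ℝ) (a b : ℂ) :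
    NormedSpace.exp ((Complex.I * (z : ℂ)) • spinZ t) *ᵥ cvec t a b =
      cvec t (Complex.exp (-(z / 2 * Complex.I)) * a) (Complex.exp (z / 2 * Complex.I) * b) := by
  rw [spinZ, ← Matrix.diagonal_smul, Matrix.exp_diagonal]
  ext k
  have hk : ((t - (k : ℕ) : ℕ) : ℂ) = (t : ℂ) - (k : ℂ) := Nat.cast_sub (Nat.lt_succ_iff.1 k.2)
  rw [Matrix.mulVec_diagonal, Pi.coe_exp, ← Complex.exp_eq_exp_ℂ, cvec, cvec, mul_pow, mul_pow,
    ← Complex.exp_nat_mul, ← Complex.exp_nat_mul, hk]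
  have he : Complex.exp (((Complex.I * (z : ℂ)) • fun k : Fin (t + 1) =>
      ((k : ℕ) : ℂ) - (t : ℂ) / 2) k) = Complex.exp (((t : ℂ) - (k : ℂ)) * -(z / 2 * Complex.I)) *
        Complex.exp ((k : ℂ) * (z / 2 * Complex.I)) := by
    rw [← Complex.exp_add, Pi.smul_apply, smul_eq_mul]
    congr 1
    ring
  rw [he]
  ring

theorem mul_star_add_mul_star_eq_one_iff {x y : ℂ} :
    x * star x + y * star y = 1 ↔ ‖x‖ ^ 2 + ‖y‖ ^ 2 = 1 := by
  rw [Complex.star_def, Complex.mul_conj', Complex.mul_conj']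
  norm_cast

theorem rotation_mulVec_cvec (t : ℕ) (θ φ z γ : ℝ) (a b : ℂ) :
    rotation t θ φ z γ *ᵥ cvec t a b = Complex.exp (Complex.I * γ) •
      cvec t (Complex.exp (-(z / 2 * Complex.I)) * a * Real.cos (θ / 2) -
          Complex.exp (z / 2 * Complex.I) * b *
            (Complex.exp (φ * Complex.I) * Real.sin (θ / 2)))
        (Complex.exp (-(z / 2 * Complex.I)) * a *
            (Complex.exp (-(φ * Complex.I)) * Real.sin (θ / 2)) +
          Complex.exp (z / 2 * Complex.I) * b * Real.cos (θ / 2)) := by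
  rw [rotation, Matrix.smul_mulVec, ← Matrix.mulVec_mulVec, exp_spinZ_mulVec_cvec,
    exp_generator_mulVec_cvec]

theorem coherent_eq_cvec (t : ℕ) (θ φ : ℝ) :
    coherent t θ φ = cvec t (Real.cos (θ / 2))
      (Complex.exp (-(φ * Complex.I)) * Real.sin (θ / 2)) := by
  rw [coherent, lowest_eq_cvec, rotation_mulVec_cvec]
  simp

theorem rotation_conjTranspose_mul_self (t : ℕ) (θ φ z γ : ℝ) :
    (rotation t θ φ z γ)ᴴ * rotation t θ φ z γ = 1 := by
  have hx : (spinX t)ᴴ = spinX t := by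
    simp only [spinX, Matrix.conjTranspose_smul, Matrix.conjTranspose_add,
      Matrix.conjTranspose_conjTranspose]
    rw [add_comm (spinUp t)]
    simp
  have hy : (spinY t)ᴴ = spinY t := by
    simp only [spinY, Matrix.conjTranspose_smul, Matrix.conjTranspose_sub,
      Matrix.conjTranspose_conjTranspose]
    rw [← neg_sub (spinUp t), smul_neg, ← neg_smul]
    simp
  have hz : (spinZ t)ᴴ = spinZ t := by
    rw [spinZ, Matrix.diagonal_conjTranspose]
    congr 1
    ext k
    simp
  have h1 := exp_mem_unitary_of_conjTranspose_eq_neg (B := (Complex.I * (θ : ℂ)) •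
        ((Real.cos φ : ℂ) • spinY t - (Real.sin φ : ℂ) • spinX t)) (by
    rw [Matrix.conjTranspose_smul, Matrix.conjTranspose_sub, Matrix.conjTranspose_smul,
      Matrix.conjTranspose_smul, hx, hy, ← neg_smul, Complex.star_def, Complex.conj_ofReal,
      Complex.conj_ofReal]
    simp)
  have h2 := exp_mem_unitary_of_conjTranspose_eq_neg (B := (Complex.I * (z : ℂ)) • spinZ t) (by
    rw [Matrix.conjTranspose_smul, hz, ← neg_smul]
    simp)
  have h3 : star (Complex.exp (Complex.I * γ)) * Complex.exp (Complex.I * γ) = 1 := by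
    rw [Complex.star_def, ← Complex.exp_conj, ← Complex.exp_add]
    simp
  rw [rotation, Matrix.conjTranspose_smul, Matrix.smul_mul, Matrix.mul_smul, smul_smul, h3,
    one_smul, Matrix.conjTranspose_mul, Matrix.mul_assoc, ← Matrix.mul_assoc _ (NormedSpace.exp _), h1,
    Matrix.one_mul, h2]

/-- Rotations act transitively, up to a phase, on the vectors `cvec t a b` with `|a|² + |b|² = 1`. -/
theorem exists_rotation_mulVec_cvec (t : ℕ) {a b c d : ℂ} (hab : ‖a‖ ^ 2 + ‖b‖ ^ 2 = 1)
    (hcd : ‖c‖ ^ 2 + ‖d‖ ^ 2 = 1) :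
    ∃ V ∈ rotationGroup t, ∃ ζ : ℂ, ‖ζ‖ = 1 ∧ V *ᵥ cvec t a b = ζ • cvec t c d := by
  have hab' : a * star a + b * star b = 1 := mul_star_add_mul_star_eq_one_iff.2 hab
  have hcd' : c * star c + d * star d = 1 := mul_star_add_mul_star_eq_one_iff.2 hcd
  -- The `SU(2)` matrix with rows `(α, -star β)` and `(β, star α)` carries `(a, b)` to `(c, d)`; its
  -- Euler angles are read off from the moduli and arguments of `α` and `β`.
  set α : ℂ := c * star a + star d * b with hα
  set β : ℂ := d * star a - star c * b with hβ
  have hαβ : ‖α‖ ^ 2 + ‖β‖ ^ 2 = 1 := by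
    have : α * star α + β * star β = 1 := by
      simp only [hα, hβ, star_add, star_sub, star_mul', star_star]
      linear_combination (c * star c + d * star d) * hab' + hcd'
    exact mul_star_add_mul_star_eq_one_iff.1 this
  set x := Complex.arg α
  set y := Complex.arg β
  have hx : α = ‖α‖ * Complex.exp (x * Complex.I) := (Complex.norm_mul_exp_arg_mul_I α).symm
  have hy : β = ‖β‖ * Complex.exp (y * Complex.I) := (Complex.norm_mul_exp_arg_mul_I β).symm
  have hx' : star α = ‖α‖ * Complex.exp (-(x * Complex.I)) := by
    conv_lhs => rw [hx]
    rw [star_mul', Complex.star_def, ← Complex.exp_conj]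
    simp
  have hy' : star β = ‖β‖ * Complex.exp (-(y * Complex.I)) := by
    conv_lhs => rw [hy]
    rw [star_mul', Complex.star_def, ← Complex.exp_conj]
    simp
  have hmod : ∀ r : ℝ, Complex.exp ((toIcoMod Real.two_pi_pos 0 r : ℝ) * Complex.I) =
      Complex.exp (r * Complex.I) := by
    intro r
    rw [Complex.exp_eq_exp_iff_exists_int]
    refine ⟨-toIcoDiv Real.two_pi_pos 0 r, ?_⟩
    rw [toIcoMod]
    push_cast
    simp only [zsmul_eq_mul]
    ring
  have hmem : ∀ r : ℝ, toIcoMod Real.two_pi_pos 0 r ∈ Set.Ico 0 (2 * Real.pi) := by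
    intro r
    simpa using toIcoMod_mem_Ico Real.two_pi_pos 0 r
  have hα0 : 0 ≤ ‖α‖ := norm_nonneg _
  have hα1 : ‖α‖ ≤ 1 := by nlinarith [sq_nonneg ‖β‖]
  set θ := 2 * Real.arccos ‖α‖
  have hcos : Real.cos (θ / 2) = ‖α‖ := by
    rw [mul_div_cancel_left₀ _ two_ne_zero, Real.cos_arccos (by linarith) hα1]
  have hsin : Real.sin (θ / 2) = ‖β‖ := by
    rw [mul_div_cancel_left₀ _ two_ne_zero, Real.sin_arccos, ← hαβ, add_sub_cancel_left,
      Real.sqrt_sq (norm_nonneg _)]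
  have hθ : θ ∈ Set.Icc 0 Real.pi := by
    have := Real.arccos_nonneg ‖α‖
    have := Real.arccos_le_pi_div_two.2 hα0
    constructor <;> simp only [θ] <;> linarith
  set z := toIcoMod Real.two_pi_pos 0 (-2 * x)
  set φ := toIcoMod Real.two_pi_pos 0 (x - y)
  have hφ : Complex.exp (φ * Complex.I) =
      Complex.exp (x * Complex.I) * Complex.exp (-(y * Complex.I)) := by
    rw [hmod, ← Complex.exp_add]
    congr 1
    push_cast
    ring
  have hφ' : Complex.exp (-(φ * Complex.I)) =
      Complex.exp (-(x * Complex.I)) * Complex.exp (y * Complex.I) := by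
    rw [Complex.exp_neg, hφ, mul_inv, ← Complex.exp_neg, ← Complex.exp_neg, neg_neg]
  -- Reducing `z` modulo `2π` can flip the sign of `exp (i z / 2)`. The sign `η` factors out of both
  -- parameters and becomes the phase `η ^ t`.
  set η := Complex.exp (-(z / 2 * Complex.I)) * Complex.exp (-(x * Complex.I)) with hη
  have hxx : Complex.exp (-(x * Complex.I)) * Complex.exp (x * Complex.I) = 1 := by
    rw [← Complex.exp_add, neg_add_cancel, Complex.exp_zero]
  have hzz : Complex.exp (-(z / 2 * Complex.I)) * Complex.exp (z / 2 * Complex.I) = 1 := by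
    rw [← Complex.exp_add, neg_add_cancel, Complex.exp_zero]
  have hzx : Complex.exp (z / 2 * Complex.I) ^ 2 = Complex.exp (-(x * Complex.I)) ^ 2 := by
    rw [← Complex.exp_nat_mul, ← Complex.exp_nat_mul]
    convert hmod (-2 * x) using 2
    · push_cast
      simp only [z]
      ring
    · push_cast
      ring
  have hz1 : Complex.exp (-(z / 2 * Complex.I)) = η * Complex.exp (x * Complex.I) := by
    rw [hη, mul_assoc, hxx, mul_one]
  have hz2 : Complex.exp (z / 2 * Complex.I) = η * Complex.exp (-(x * Complex.I)) := by
    rw [hη, mul_assoc, ← pow_two, ← hzx, pow_two, ← mul_assoc, hzz, one_mul]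
  refine ⟨rotation t θ φ z 0, ⟨θ, hθ, φ, hmem _, z, hmem _, 0, ⟨le_rfl, Real.two_pi_pos⟩, rfl⟩,
    η ^ t, ?_, ?_⟩
  · rw [norm_pow, hη, norm_mul]
    have e1 : ‖Complex.exp (-(z / 2 * Complex.I))‖ = 1 := by
      have := Complex.norm_exp_ofReal_mul_I (-(z / 2))
      push_cast at this
      rwa [neg_mul] at this
    have e2 : ‖Complex.exp (-(x * Complex.I))‖ = 1 := by
      have := Complex.norm_exp_ofReal_mul_I (-x)
      push_cast at this
      rwa [neg_mul] at this
    rw [e1, e2, one_mul, one_pow]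
  · rw [rotation_mulVec_cvec, ← cvec_smul, hcos, hsin, hφ, hφ', hz1, hz2]
    have ec : c = α * a - star β * b := by
      simp only [hα, hβ, star_sub, star_mul', star_star]
      linear_combination -c * hab'
    have ed : d = β * a + star α * b := by
      simp only [hα, hβ, star_add, star_mul', star_star]
      linear_combination -d * hab'
    rw [Complex.ofReal_zero, mul_zero, Complex.exp_zero, one_smul]
    congr 1
    · rw [ec, hy']
      linear_combination (-η * b * Complex.exp (-(y * Complex.I)) * ‖β‖) * hxx - η * a * hx
    · rw [ed, hx']
      linear_combination (η * a * Complex.exp (y * Complex.I) * ‖β‖) * hxx - η * a * hy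

/-- Rotations preserve, up to a phase, the set of vectors `cvec t a b` with `|a|² + |b|² = 1`. -/
theorem exists_mulVec_cvec_eq {t : ℕ} {V : Matrix (Fin (t + 1)) (Fin (t + 1)) ℂ}
    (hV : V ∈ rotationGroup t) {a b : ℂ} (hab : ‖a‖ ^ 2 + ‖b‖ ^ 2 = 1) :
    ∃ c d ζ : ℂ, ‖c‖ ^ 2 + ‖d‖ ^ 2 = 1 ∧ ‖ζ‖ = 1 ∧ V *ᵥ cvec t a b = ζ • cvec t c d := by
  obtain ⟨θ, -, φ, -, z, -, γ, -, rfl⟩ := hV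
  refine ⟨_, _, _, ?_, ?_, rotation_mulVec_cvec t θ φ z γ a b⟩
  · have hab' : a * star a + b * star b = 1 := mul_star_add_mul_star_eq_one_iff.2 hab
    have hcs : ((Real.cos (θ / 2) : ℝ) : ℂ) ^ 2 + ((Real.sin (θ / 2) : ℝ) : ℂ) ^ 2 = 1 := by
      exact_mod_cast Real.cos_sq_add_sin_sq (θ / 2)
    have e : ∀ x : ℂ, star (Complex.exp (x * Complex.I)) = Complex.exp (-(star x * Complex.I)) := by
      intro x
      rw [Complex.star_def, ← Complex.exp_conj]
      simp
    have e' : ∀ x : ℂ, star (Complex.exp (-(x * Complex.I))) = Complex.exp (star x * Complex.I) := by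
      intro x
      rw [Complex.star_def, ← Complex.exp_conj]
      simp
    have hi : ∀ x : ℂ, Complex.exp (-(x * Complex.I)) * Complex.exp (x * Complex.I) = 1 := by
      intro x
      rw [← Complex.exp_add, neg_add_cancel, Complex.exp_zero]
    have h1 := hi (z / 2)
    have h2 := hi φ
    apply mul_star_add_mul_star_eq_one_iff.1
    have hz : star ((z : ℂ) / 2) = z / 2 := by simp
    have hφ : star (φ : ℂ) = φ := by simp
    have hr : ∀ r : ℝ, star (r : ℂ) = r := fun r => by simp
    simp only [star_sub, star_add, star_mul', e, e', hz, hφ, hr]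
    set c := ((Real.cos (θ / 2) : ℝ) : ℂ)
    set s := ((Real.sin (θ / 2) : ℝ) : ℂ)
    set u := Complex.exp (-((z : ℂ) / 2 * Complex.I))
    set u' := Complex.exp ((z : ℂ) / 2 * Complex.I)
    set f := Complex.exp (-((φ : ℂ) * Complex.I))
    set f' := Complex.exp ((φ : ℂ) * Complex.I)
    linear_combination (u * u' * s ^ 2 * (a * star a + b * star b)) * h2 +
      (c ^ 2 + s ^ 2) * (a * star a + b * star b) * h1 + (c ^ 2 + s ^ 2) * hab' + hcs
  · rw [Complex.norm_exp]
    simp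

theorem exists_eq_smul_cvec {t : ℕ} {ψ : Fin (t + 1) → ℂ} (hψ : ψ ∈ coherentStates t) :
    ∃ c d ζ : ℂ, ‖c‖ ^ 2 + ‖d‖ ^ 2 = 1 ∧ ‖ζ‖ = 1 ∧ ψ = ζ • cvec t c d := by
  obtain ⟨V, hV, rfl⟩ := hψ
  rw [lowest_eq_cvec]
  exact exists_mulVec_cvec_eq hV (by simp)

theorem exists_coherentStates_eq (t : ℕ) {c d : ℂ} (hcd : ‖c‖ ^ 2 + ‖d‖ ^ 2 = 1) :
    ∃ ψ ∈ coherentStates t, ∃ ζ : ℂ, ‖ζ‖ = 1 ∧ ψ = ζ • cvec t c d := by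
  obtain ⟨V, hV, ζ, hζ, h⟩ := exists_rotation_mulVec_cvec t (a := 1) (b := 0) (by simp) hcd
  exact ⟨_, ⟨V, hV, rfl⟩, ζ, hζ, by rw [lowest_eq_cvec, h]⟩

/-! ### Density operators of copies, where phases disappear -/

theorem copies_smul {t : ℕ} (n : ℕ) {ζ : ℂ} (hζ : ‖ζ‖ = 1) (ψ : Fin (t + 1) → ℂ) :
    copies n (ζ • ψ) = copies n ψ := by
  have h1 : tensorVec n (ζ • ψ) = ζ ^ n • tensorVec n ψ := by
    ext x
    simp [tensorVec, Finset.prod_mul_distrib]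
  have h2 : ζ ^ n * star (ζ ^ n) = 1 := by
    rw [Complex.star_def, Complex.mul_conj', norm_pow, hζ]
    simp
  rw [copies, copies, h1, ketbra, ketbra, star_smul, Matrix.smul_vecMulVec,
    Matrix.vecMulVec_smul, smul_smul, h2, one_smul]

/-- The rotation group acts on the density operators of coherent states. -/
theorem exists_copies_mulVec_eq {t : ℕ} {V : Matrix (Fin (t + 1)) (Fin (t + 1)) ℂ}
    (hV : V ∈ rotationGroup t) {φ : Fin (t + 1) → ℂ} (hφ : φ ∈ coherentStates t) (n : ℕ) :
    ∃ ψ ∈ coherentStates t, copies n (V *ᵥ φ) = copies n ψ := by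
  obtain ⟨a, b, ζ, hab, hζ, rfl⟩ := exists_eq_smul_cvec hφ
  obtain ⟨c, d, ζ', hcd, hζ', h⟩ := exists_mulVec_cvec_eq hV hab
  obtain ⟨ψ, hψ, ξ, hξ, rfl⟩ := exists_coherentStates_eq t hcd
  exact ⟨_, hψ, by rw [Matrix.mulVec_smul, h, copies_smul n hζ, copies_smul n hζ',
    copies_smul n hξ]⟩

/-- The rotation group acts transitively on the density operators of coherent states. -/
theorem exists_copies_mulVec_eq_copies {t : ℕ} {φ ψ : Fin (t + 1) → ℂ}
    (hφ : φ ∈ coherentStates t) (hψ : ψ ∈ coherentStates t) (n : ℕ) :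
    ∃ V ∈ rotationGroup t, copies n (V *ᵥ φ) = copies n ψ := by
  obtain ⟨a, b, ζ, hab, hζ, rfl⟩ := exists_eq_smul_cvec hφ
  obtain ⟨c, d, ξ, hcd, hξ, rfl⟩ := exists_eq_smul_cvec hψ
  obtain ⟨V, hV, ζ', hζ', h⟩ := exists_rotation_mulVec_cvec t hab hcd
  exact ⟨V, hV, by rw [Matrix.mulVec_smul, h, copies_smul n hζ, copies_smul n hζ',
    copies_smul n hξ]⟩

/-! ### The subspace of maximal total spin -/

/-- The number of excitations of a product basis vector. -/
def excitation {t n : ℕ} (x : Fin n → Fin (t + 1)) : ℕ := ∑ l, (x l : ℕ)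

theorem excitation_le {t n : ℕ} (x : Fin n → Fin (t + 1)) : excitation x ≤ n * t := by
  calc excitation x ≤ ∑ _l : Fin n, t := Finset.sum_le_sum fun l _ => Nat.lt_succ_iff.1 (x l).2
    _ = n * t := by simp

/-- The unnormalised totally symmetric vector with `k` excitations. -/
noncomputable def dicke (t n k : ℕ) : (Fin n → Fin (t + 1)) → ℂ := fun x =>
  if excitation x = k then ∏ l, ((Real.sqrt (t.choose (x l)) : ℝ) : ℂ) else 0

theorem tensorVec_cvec (t n : ℕ) (a b : ℂ) (x : Fin n → Fin (t + 1)) :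
    tensorVec n (cvec t a b) x = (∏ l, ((Real.sqrt (t.choose (x l)) : ℝ) : ℂ)) *
      (a ^ (n * t - excitation x) * b ^ excitation x) := by
  have h : ∑ l, (t - (x l : ℕ)) = n * t - excitation x := by
    rw [eq_tsub_iff_add_eq_of_le (excitation_le x), excitation, ← Finset.sum_add_distrib]
    simp [Nat.sub_add_cancel (Nat.lt_succ_iff.1 (x _).2)]
  simp only [tensorVec, cvec]
  rw [Finset.prod_mul_distrib, Finset.prod_mul_distrib, Finset.prod_pow_eq_pow_sum,
    Finset.prod_pow_eq_pow_sum, h, excitation]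

theorem tensorVec_lowest (t n : ℕ) : tensorVec n (lowest t) = dicke t n 0 := by
  ext x
  rw [lowest_eq_cvec, tensorVec_cvec, dicke]
  split_ifs with h <;> simp [h]

theorem excitation_update {t n : ℕ} (x : Fin n → Fin (t + 1)) (l : Fin n) (j : Fin (t + 1)) :
    excitation (Function.update x l j) + (x l : ℕ) = excitation x + (j : ℕ) := by
  rw [excitation, excitation, ← Finset.add_sum_erase _ _ (Finset.mem_univ l),
    ← Finset.add_sum_erase _ (fun l => (x l : ℕ)) (Finset.mem_univ l)]
  have : ∑ i ∈ Finset.univ.erase l, ((Function.update x l j i : Fin (t + 1)) : ℕ) =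
      ∑ i ∈ Finset.univ.erase l, (x i : ℕ) :=
    Finset.sum_congr rfl fun i hi => by rw [Function.update_of_ne (Finset.ne_of_mem_erase hi)]
  rw [this, Function.update_self]
  ring

/-- Raising in factor `l` contributes `x l` times the next Dicke amplitude: this is
`spinUp_mulVec_cvec` at `a = b = 1`. The numbers `x l` add up to `k + 1` on the support. -/
theorem totalUp_mulVec_dicke (t n k : ℕ) :
    totalUp t n *ᵥ dicke t n k = ((k : ℂ) + 1) • dicke t n (k + 1) := by
  classical
  ext x
  -- The `y` agreeing with `x` away from `l` are exactly the updates of `x` at `l`.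
  have hsum : ∀ l, ∑ y : Fin n → Fin (t + 1),
      (if ∀ l', l' ≠ l → x l' = y l' then spinUp t (x l) (y l) else 0) * dicke t n k y =
        ∑ j, spinUp t (x l) j * dicke t n k (Function.update x l j) := by
    intro l
    simp_rw [ite_mul, zero_mul]
    rw [← Finset.sum_filter]
    refine Finset.sum_bij' (fun y _ => y l) (fun j _ => Function.update x l j) ?_ ?_ ?_ ?_ ?_
    · simp
    · intro j _
      simp +contextual [Function.update_of_ne]
    · intro y hy
      ext l'
      by_cases h : l' = l
      · subst h; simp
      · rw [Function.update_of_ne h, (Finset.mem_filter.1 hy).2 l' h]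
    · simp
    · intro y hy
      have : Function.update x l (y l) = y := by
        ext l'
        by_cases h : l' = l
        · subst h; simp
        · rw [Function.update_of_ne h, (Finset.mem_filter.1 hy).2 l' h]
      rw [this]
  have hterm : ∀ l, ∑ j, spinUp t (x l) j * dicke t n k (Function.update x l j) =
      (x l : ℕ) * dicke t n (k + 1) x := by
    intro l
    have hj : ∀ j, spinUp t (x l) j * dicke t n k (Function.update x l j) =
        (if excitation x = k + 1 then
          ∏ i ∈ Finset.univ.erase l, ((Real.sqrt (t.choose (x i)) : ℝ) : ℂ) else 0) *
          (spinUp t (x l) j * cvec t 1 1 j) := by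
      intro j
      by_cases h : (x l : ℕ) = j + 1
      · have he : excitation (Function.update x l j) = k ↔ excitation x = k + 1 := by
          have := excitation_update x l j
          omega
        simp only [dicke, he]
        split_ifs
        · rw [← Finset.mul_prod_erase _ _ (Finset.mem_univ l), Function.update_self]
          have : ∏ i ∈ Finset.univ.erase l,
              ((Real.sqrt (t.choose (Function.update x l j i : Fin (t + 1))) : ℝ) : ℂ) =
              ∏ i ∈ Finset.univ.erase l, ((Real.sqrt (t.choose (x i)) : ℝ) : ℂ) :=
            Finset.prod_congr rfl fun i hi => by
              rw [Function.update_of_ne (Finset.ne_of_mem_erase hi)]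
          rw [this]
          simp only [cvec, one_pow, mul_one]
          ring
        · simp
      · simp [spinUp, h]
    have hs := spinUp_mulVec_cvec t 1 1 (x l)
    rw [Matrix.mulVec, dotProduct] at hs
    rw [Finset.sum_congr rfl fun j _ => hj j, ← Finset.mul_sum, hs, dicke]
    split_ifs
    · rw [← Finset.mul_prod_erase _ _ (Finset.mem_univ l)]
      simp only [one_pow, mul_one]
      ring
    · simp
  have : (totalUp t n *ᵥ dicke t n k) x = ∑ l : Fin n, ((x l : ℕ) : ℂ) * dicke t n (k + 1) x := by
    rw [Matrix.mulVec, dotProduct]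
    simp only [totalUp, Finset.sum_mul]
    rw [Finset.sum_comm]
    exact Finset.sum_congr rfl fun l _ => by rw [hsum, hterm]
  rw [this, ← Finset.sum_mul, Pi.smul_apply, smul_eq_mul, dicke]
  split_ifs with h
  · rw [excitation] at h
    rw [← Nat.cast_sum, h]
    push_cast
    rfl
  · simp

theorem totalUp_pow_mulVec_dicke (t n k : ℕ) :
    totalUp t n ^ k *ᵥ dicke t n 0 = (k.factorial : ℂ) • dicke t n k := by
  induction k with
  | zero => simp
  | succ k ih =>
    rw [pow_succ', ← Matrix.mulVec_mulVec, ih, Matrix.mulVec_smul, totalUp_mulVec_dicke, smul_smul,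
      Nat.factorial_succ]
    push_cast
    rw [mul_comm]

theorem totalSpinState_eq (t n : ℕ) {k : ℕ} (hk : k ≤ n * t) :
    totalSpinState t n k = (((Real.sqrt ((n * t).choose k))⁻¹ : ℝ) : ℂ) • dicke t n k := by
  rw [totalSpinState, tensorVec_lowest, totalUp_pow_mulVec_dicke, smul_smul]
  congr 1
  have : Real.sqrt (((n * t - k).factorial : ℝ) / ((k.factorial : ℝ) * ((n * t).factorial : ℝ))) *
      (k.factorial : ℝ) = (Real.sqrt ((n * t).choose k))⁻¹ := by
    have h0 : (0 : ℝ) ≤ k.factorial := Nat.cast_nonneg _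
    have h1 : (k.factorial : ℝ) ≠ 0 := Nat.cast_ne_zero.2 (Nat.factorial_ne_zero _)
    have h2 : ((n * t).factorial : ℝ) ≠ 0 := Nat.cast_ne_zero.2 (Nat.factorial_ne_zero _)
    have h3 : ((n * t - k).factorial : ℝ) ≠ 0 := Nat.cast_ne_zero.2 (Nat.factorial_ne_zero _)
    have h4 := Real.sqrt_mul' (((n * t - k).factorial : ℝ) /
      ((k.factorial : ℝ) * ((n * t).factorial : ℝ))) (sq_nonneg (k.factorial : ℝ))
    rw [Real.sqrt_sq h0] at h4
    rw [← h4, ← Real.sqrt_inv, Nat.cast_choose ℝ hk]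
    congr 1
    field_simp
  exact_mod_cast this

/-- Vandermonde's identity for `n` factors, from the coefficient of `X^k` in `((1 + X)^t)^n`. It
gives the squared norm of `dicke t n k`. -/
theorem sum_excitation_choose (t n k : ℕ) :
    ∑ x : Fin n → Fin (t + 1), (if excitation x = k then ∏ l, t.choose (x l) else 0) =
      (n * t).choose k := by
  have h : (∑ x : Fin n → Fin (t + 1),
      Polynomial.C (∏ l, t.choose (x l)) * Polynomial.X ^ excitation x : Polynomial ℕ) =
        (1 + Polynomial.X) ^ (n * t) := by
    have h1 : (1 + Polynomial.X : Polynomial ℕ) ^ t =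
        ∑ j : Fin (t + 1), Polynomial.C (t.choose j) * Polynomial.X ^ (j : ℕ) := by
      rw [add_comm, add_pow, Finset.sum_range]
      simp [mul_comm]
    rw [mul_comm n t, pow_mul, h1, Fintype.sum_pow]
    refine Finset.sum_congr rfl fun x _ => ?_
    rw [Finset.prod_mul_distrib, Finset.prod_pow_eq_pow_sum, map_prod, excitation]
  have := congrArg (fun p => p.coeff k) h
  simp only [Polynomial.finsetSum_coeff, Polynomial.coeff_C_mul, Polynomial.coeff_X_pow,
    Polynomial.coeff_one_add_X_pow] at this
  simp only [Nat.cast_id] at this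
  rw [← this]
  refine Finset.sum_congr rfl fun x _ => ?_
  simp [eq_comm]

/-- The matrix whose columns are the states of total spin `n t / 2`. -/
noncomputable def spinIsometry (t n : ℕ) : Matrix (Fin n → Fin (t + 1)) (Fin (n * t + 1)) ℂ :=
  fun x k => totalSpinState t n k x

theorem spinProj_eq (t n : ℕ) : spinProj t n = spinIsometry t n * (spinIsometry t n)ᴴ := by
  ext x y
  rw [spinProj, Finset.sum_range, Matrix.sum_apply, Matrix.mul_apply]
  rfl

theorem spinIsometry_apply (t n : ℕ) (x : Fin n → Fin (t + 1)) (k : Fin (n * t + 1)) :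
    spinIsometry t n x k = if excitation x = k then
      (((Real.sqrt ((n * t).choose k))⁻¹ * ∏ l, Real.sqrt (t.choose (x l)) : ℝ) : ℂ) else 0 := by
  rw [spinIsometry, totalSpinState_eq t n (Nat.lt_succ_iff.1 k.2), Pi.smul_apply, dicke]
  split_ifs <;> simp

/-- Different columns have disjoint supports, and `sum_excitation_choose` normalises each one. Hence
`spinProj` is a projection of trace `n t + 1`. -/
theorem spinIsometry_conjTranspose_mul_self (t n : ℕ) :
    (spinIsometry t n)ᴴ * spinIsometry t n = 1 := by
  ext j k
  simp only [Matrix.mul_apply, Matrix.conjTranspose_apply, spinIsometry_apply]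
  by_cases hjk : j = k
  · subst hjk
    have hc : ((n * t).choose j : ℝ) ≠ 0 :=
      Nat.cast_ne_zero.2 (Nat.choose_pos (Nat.lt_succ_iff.1 j.2)).ne'
    have hx : ∀ x : Fin n → Fin (t + 1), star (if excitation x = j then
        (((Real.sqrt ((n * t).choose j))⁻¹ * ∏ l, Real.sqrt (t.choose (x l)) : ℝ) : ℂ) else 0) *
        (if excitation x = j then
        (((Real.sqrt ((n * t).choose j))⁻¹ * ∏ l, Real.sqrt (t.choose (x l)) : ℝ) : ℂ) else 0) =
        (((n * t).choose j : ℝ)⁻¹ : ℝ) *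
          ((if excitation x = j then ∏ l, t.choose (x l) else 0 : ℕ) : ℂ) := by
      intro x
      split_ifs
      · rw [Complex.star_def, Complex.conj_ofReal, ← Complex.ofReal_mul, mul_mul_mul_comm,
          ← mul_inv, Real.mul_self_sqrt (Nat.cast_nonneg _), ← Finset.prod_mul_distrib,
          Finset.prod_congr rfl fun l _ => Real.mul_self_sqrt (Nat.cast_nonneg (t.choose (x l)))]
        push_cast
        rfl
      · simp
    rw [Finset.sum_congr rfl fun x _ => hx x, ← Finset.mul_sum, ← Nat.cast_sum,
      sum_excitation_choose, Matrix.one_apply_eq]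
    exact_mod_cast inv_mul_cancel₀ hc
  · rw [Matrix.one_apply_ne hjk]
    refine Finset.sum_eq_zero fun x _ => ?_
    split_ifs with h1 h2
    · exact absurd (Fin.ext (h1.symm.trans h2)) hjk
    · simp
    · simp
    · simp

/-- Reduces `n` copies to a single spin `n t / 2`: the amplitude of a product vector depends on `(a,
b)` only through its excitation number. -/
theorem tensorVec_cvec_eq (t n : ℕ) (a b : ℂ) :
    tensorVec n (cvec t a b) = spinIsometry t n *ᵥ cvec (n * t) a b := by
  ext x
  rw [tensorVec_cvec, Matrix.mulVec, dotProduct, Finset.sum_eq_single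
    (⟨excitation x, Nat.lt_succ_iff.2 (excitation_le x)⟩ : Fin (n * t + 1))]
  · have hc : Real.sqrt ((n * t).choose (excitation x)) ≠ 0 := by
      rw [Real.sqrt_ne_zero']
      exact_mod_cast Nat.choose_pos (excitation_le x)
    have hc' : (Real.sqrt ((n * t).choose (excitation x)) : ℂ) ≠ 0 := by exact_mod_cast hc
    rw [spinIsometry_apply, if_pos rfl, cvec]
    push_cast
    field_simp
  · intro k _ hk
    rw [spinIsometry_apply, if_neg fun h => hk (Fin.ext h.symm), zero_mul]
  · simp

theorem copies_cvec (t n : ℕ) (a b : ℂ) : copies n (cvec t a b) =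
    spinIsometry t n * ketbra (cvec (n * t) a b) * (spinIsometry t n)ᴴ := by
  rw [copies, tensorVec_cvec_eq, ketbra, ketbra, Matrix.star_mulVec, Matrix.mul_vecMulVec,
    Matrix.vecMulVec_mul]

theorem spinProj_mul_self (t n : ℕ) : spinProj t n * spinProj t n = spinProj t n := by
  rw [spinProj_eq, Matrix.mul_assoc, ← Matrix.mul_assoc _ᴴ, spinIsometry_conjTranspose_mul_self,
    Matrix.one_mul]

theorem spinProj_conjTranspose (t n : ℕ) : (spinProj t n)ᴴ = spinProj t n := by
  rw [spinProj_eq, Matrix.conjTranspose_mul, Matrix.conjTranspose_conjTranspose]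

theorem spinProj_trace (t n : ℕ) : (spinProj t n).trace = (n : ℂ) * t + 1 := by
  rw [spinProj_eq, Matrix.trace_mul_comm, spinIsometry_conjTranspose_mul_self, Matrix.trace_one]
  simp

theorem spinProj_mul_copies {t : ℕ} (n : ℕ) {ψ : Fin (t + 1) → ℂ} (hψ : ψ ∈ coherentStates t) :
    spinProj t n * copies n ψ = copies n ψ := by
  obtain ⟨a, b, ζ, -, hζ, rfl⟩ := exists_eq_smul_cvec hψ
  rw [copies_smul n hζ, copies_cvec, spinProj_eq, Matrix.mul_assoc, Matrix.mul_assoc,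
    ← Matrix.mul_assoc _ᴴ, spinIsometry_conjTranspose_mul_self, Matrix.one_mul]

theorem copies_conjTranspose {t : ℕ} (n : ℕ) (ψ : Fin (t + 1) → ℂ) :
    (copies n ψ)ᴴ = copies n ψ := by
  rw [copies, ketbra, Matrix.conjTranspose_vecMulVec, star_star]

theorem copies_mul_spinProj {t : ℕ} (n : ℕ) {ψ : Fin (t + 1) → ℂ} (hψ : ψ ∈ coherentStates t) :
    copies n ψ * spinProj t n = copies n ψ := by
  have := congrArg Matrix.conjTranspose (spinProj_mul_copies n hψ)
  rwa [Matrix.conjTranspose_mul, copies_conjTranspose, spinProj_conjTranspose] at this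

theorem copies_trace {t : ℕ} (n : ℕ) {ψ : Fin (t + 1) → ℂ} (hψ : ψ ∈ coherentStates t) :
    (copies n ψ).trace = 1 := by
  obtain ⟨a, b, ζ, hab, hζ, rfl⟩ := exists_eq_smul_cvec hψ
  rw [copies_smul n hζ, copies_cvec, Matrix.trace_mul_comm, ← Matrix.mul_assoc,
    spinIsometry_conjTranspose_mul_self, Matrix.one_mul, ketbra, Matrix.trace_vecMulVec, dotProduct]
  have hk : ∀ k : Fin (n * t + 1), cvec (n * t) a b k * star (cvec (n * t) a b) k =
      ((‖b‖ ^ 2) ^ (k : ℕ) * (‖a‖ ^ 2) ^ (n * t - k) * ((n * t).choose k : ℝ) : ℝ) := by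
    intro k
    rw [Pi.star_apply, Complex.star_def, Complex.mul_conj', cvec, norm_mul, norm_mul, norm_pow,
      norm_pow, Complex.norm_real, Real.norm_of_nonneg (Real.sqrt_nonneg _), ← Complex.ofReal_pow,
      mul_pow, Real.sq_sqrt (Nat.cast_nonneg _)]
    congr 1
    ring
  rw [Finset.sum_congr rfl fun k _ => hk k, ← Complex.ofReal_sum,
    ← Finset.sum_range (fun k => (‖b‖ ^ 2) ^ k * (‖a‖ ^ 2) ^ (n * t - k) * ((n * t).choose k : ℝ)),
    ← add_pow, add_comm, hab]
  simp

/-! ### Gauss and Gauss-Radau quadrature -/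

section Quadrature

open Polynomial

/-- The linear functional `f ↦ ∫ x in -1..1, f x` on polynomials. -/
noncomputable def polyIntegral : ℝ[X] →ₗ[ℝ] ℝ where
  toFun f := ∫ x in (-1 : ℝ)..1, f.eval x
  map_add' f g := by
    simp only [eval_add]
    exact intervalIntegral.integral_add (f.continuous.intervalIntegrable _ _)
      (g.continuous.intervalIntegrable _ _)
  map_smul' c f := by
    simp

theorem polyIntegral_pos {f : ℝ[X]} (hf : f ≠ 0) (h : ∀ x ∈ Set.Icc (-1 : ℝ) 1, 0 ≤ f.eval x) :
    0 < polyIntegral f := by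
  obtain ⟨c, hc, hfc⟩ : ∃ c ∈ Set.Icc (-1 : ℝ) 1, f.eval c ≠ 0 := by
    by_contra! hcon
    exact hf (Polynomial.eq_zero_of_infinite_isRoot f
      ((Set.Icc_infinite (by norm_num : (-1 : ℝ) < 1)).mono hcon))
  exact intervalIntegral.integral_pos (by norm_num) f.continuous.continuousOn
    (fun x hx => h x (Set.Ioc_subset_Icc_self hx)) ⟨c, hc, lt_of_le_of_ne (h c hc) hfc.symm⟩

variable {ω : ℝ[X]}

/-- Subtract from `X^q` its orthogonal projection onto the polynomials of degree below `q`. The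
projection exists because `(r, s) ↦ ∫ r s ω` is positive definite, hence identifies this
finite-dimensional space with its dual. -/
theorem exists_monic_orthogonal (hω0 : ω ≠ 0) (hω : ∀ x ∈ Set.Icc (-1 : ℝ) 1, 0 ≤ ω.eval x)
    (q : ℕ) : ∃ p : ℝ[X], p.Monic ∧ p.natDegree = q ∧
      ∀ r : ℝ[X], r.degree < q → polyIntegral (p * r * ω) = 0 := by
  let B : degreeLT ℝ q →ₗ[ℝ] Module.Dual ℝ (degreeLT ℝ q) :=
    LinearMap.mk₂ ℝ (fun r s : degreeLT ℝ q => polyIntegral ((r : ℝ[X]) * s * ω))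
      (fun a b c => by simp [add_mul]) (fun c a b => by simp) (fun a b c => by simp [mul_add, add_mul])
      (fun c a b => by simp)
  have hB : Function.Injective B := by
    rw [injective_iff_map_eq_zero]
    intro r hr
    by_contra hne
    have hne' : (r : ℝ[X]) ≠ 0 := fun h => hne (Subtype.ext h)
    have h1 : polyIntegral ((r : ℝ[X]) * r * ω) = 0 := congrArg (fun f => f r) hr
    refine (polyIntegral_pos (mul_ne_zero (mul_ne_zero hne' hne') hω0) fun x hx => ?_).ne' h1
    rw [eval_mul, eval_mul]
    exact mul_nonneg (mul_self_nonneg _) (hω x hx)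
  have hs : Function.Surjective B :=
    (LinearMap.injective_iff_surjective_of_finrank_eq_finrank
      (Subspace.dual_finrank_eq (K := ℝ) (V := degreeLT ℝ q)).symm).1 hB
  let ψ : Module.Dual ℝ (degreeLT ℝ q) :=
    (polyIntegral ∘ₗ LinearMap.mulRight ℝ ω ∘ₗ LinearMap.mulLeft ℝ (X ^ q)).domRestrict _
  obtain ⟨r, hr⟩ := hs ψ
  have hrd : (r : ℝ[X]).degree < q := mem_degreeLT.1 r.2
  have hXr : ((X : ℝ[X]) ^ q).degree = q := degree_X_pow q
  refine ⟨X ^ q - (r : ℝ[X]), monic_X_pow_sub hrd, ?_, fun s hs => ?_⟩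
  · rw [natDegree_eq_of_degree_eq (degree_sub_eq_left_of_degree_lt (by rwa [hXr])),
      natDegree_X_pow]
  · have h : polyIntegral ((r : ℝ[X]) * s * ω) = polyIntegral (X ^ q * s * ω) :=
      congrArg (fun f => f ⟨s, mem_degreeLT.2 hs⟩) hr
    rw [sub_mul, sub_mul, map_sub, h, sub_self]

/-- If `p = (X - a) g` with `a` outside the open interval, then `X - a` has constant sign on `[-1,
1]`, so `∫ p g ω = ∫ (X - a) g² ω` cannot vanish although `g` has smaller degree than `p`. -/
theorem orthogonal_root_mem {p : ℝ[X]} (hω0 : ω ≠ 0)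
    (hω : ∀ x ∈ Set.Icc (-1 : ℝ) 1, 0 ≤ ω.eval x) (hp : p.Monic)
    (ho : ∀ r : ℝ[X], r.degree < p.degree → polyIntegral (p * r * ω) = 0) {a : ℝ}
    (ha : p.IsRoot a) : a ∈ Set.Ioo (-1 : ℝ) 1 := by
  obtain ⟨g, hg⟩ := dvd_iff_isRoot.2 ha
  have hg0 : g ≠ 0 := by
    rintro rfl
    exact hp.ne_zero (by rw [hg, mul_zero])
  have hd : g.degree < p.degree := by
    rw [hg, degree_mul, degree_X_sub_C, degree_eq_natDegree hg0]
    norm_cast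
    omega
  have h0 := ho g hd
  have hX : (X - C a : ℝ[X]) ≠ 0 := X_sub_C_ne_zero a
  have hne : (X - C a) * g * g * ω ≠ 0 := mul_ne_zero (mul_ne_zero (mul_ne_zero hX hg0) hg0) hω0
  rw [hg] at h0
  by_contra hcon
  rw [Set.mem_Ioo, not_and_or, not_lt, not_lt] at hcon
  rcases hcon with h | h
  · refine (polyIntegral_pos hne fun x hx => ?_).ne' h0
    rw [eval_mul, eval_mul, eval_mul, mul_assoc (eval x (X - C a))]
    refine mul_nonneg (mul_nonneg ?_ (mul_self_nonneg _)) (hω x hx)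
    simp only [eval_sub, eval_X, eval_C]
    linarith [hx.1]
  · refine (polyIntegral_pos (neg_ne_zero.2 hne) fun x hx => ?_).ne' (by rw [map_neg, h0, neg_zero])
    rw [eval_neg, eval_mul, eval_mul, eval_mul, mul_assoc (eval x (X - C a)), ← neg_mul, ← neg_mul]
    refine mul_nonneg (mul_nonneg ?_ (mul_self_nonneg _)) (hω x hx)
    simp only [eval_sub, eval_X, eval_C]
    linarith [hx.2]

/-- No divisor of positive degree of an orthogonal polynomial is nonnegative on `[-1, 1]` with a
square cofactor. -/
theorem not_dvd_orthogonal {p : ℝ[X]} (hω0 : ω ≠ 0)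
    (hω : ∀ x ∈ Set.Icc (-1 : ℝ) 1, 0 ≤ ω.eval x) (hp : p.Monic)
    (ho : ∀ r : ℝ[X], r.degree < p.degree → polyIntegral (p * r * ω) = 0) {d : ℝ[X]}
    (hd : 0 < d.degree) (hd0 : ∀ x, 0 ≤ d.eval x) : ¬ d ∣ p := by
  rintro ⟨g, hg⟩
  have hg0 : g ≠ 0 := by
    rintro rfl
    exact hp.ne_zero (by rw [hg, mul_zero])
  have hdne : d ≠ 0 := ne_zero_of_degree_gt hd
  have hlt : g.degree < p.degree := by
    rw [degree_eq_natDegree hdne] at hd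
    rw [hg, degree_mul, degree_eq_natDegree hg0, degree_eq_natDegree hdne]
    norm_cast at hd ⊢
    omega
  have h0 := ho g hlt
  rw [hg] at h0
  refine (polyIntegral_pos (mul_ne_zero (mul_ne_zero (mul_ne_zero hdne hg0) hg0) hω0)
    fun x hx => ?_).ne' h0
  rw [eval_mul, eval_mul, eval_mul, mul_assoc (eval x d)]
  exact mul_nonneg (mul_nonneg (hd0 x) (mul_self_nonneg _)) (hω x hx)

/-- The nodes are the roots of the orthogonal polynomial. A non-real root or a multiple root would
give a nonnegative divisor of degree two, which `not_dvd_orthogonal` forbids. -/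
theorem exists_finset_orthogonal (hω0 : ω ≠ 0) (hω : ∀ x ∈ Set.Icc (-1 : ℝ) 1, 0 ≤ ω.eval x)
    (q : ℕ) : ∃ S : Finset ℝ, S.card = q ∧ (∀ x ∈ S, x ∈ Set.Ioo (-1 : ℝ) 1) ∧
      ∀ r : ℝ[X], r.degree < q → polyIntegral ((∏ a ∈ S, (X - C a)) * r * ω) = 0 := by
  obtain ⟨p, hp, hpq, ho⟩ := exists_monic_orthogonal hω0 hω q
  have hdeg : p.degree = q := by rw [degree_eq_natDegree hp.ne_zero, hpq]
  rw [← hdeg] at ho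
  have hsplit : p.Splits := by
    refine Splits.of_splits_map (algebraMap ℝ ℂ) (IsAlgClosed.splits _) fun z hz => ?_
    have hz' : aeval z p = 0 := by
      rw [← eval_map_algebraMap]
      exact isRoot_of_mem_roots hz
    by_cases him : z.im = 0
    · exact ⟨z.re, Complex.ext rfl (by simpa using him.symm)⟩
    · exfalso
      have hdvd := p.quadratic_dvd_of_aeval_eq_zero_im_ne_zero hz' him
      refine not_dvd_orthogonal hω0 hω hp ho ?_ ?_ hdvd
      · have : (X ^ 2 - C (2 * z.re) * X + C (‖z‖ ^ 2) : ℝ[X]).natDegree = 2 := by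
          compute_degree!
        exact natDegree_pos_iff_degree_pos.1 (by omega)
      · intro x
        have : ‖z‖ ^ 2 = z.re ^ 2 + z.im ^ 2 := by
          rw [Complex.sq_norm, Complex.normSq_apply]; ring
        simp only [eval_add, eval_sub, eval_pow, eval_X, eval_mul, eval_C, this]
        nlinarith [sq_nonneg (x - z.re), sq_nonneg z.im]
  have hnodup : p.roots.Nodup := by
    rw [Multiset.nodup_iff_count_le_one]
    intro a
    rw [count_roots]
    by_contra! h
    have hdvd : (X - C a) ^ 2 ∣ p := (pow_dvd_pow _ h).trans (pow_rootMultiplicity_dvd p a)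
    refine not_dvd_orthogonal hω0 hω hp ho ?_ ?_ hdvd
    · rw [degree_pow, degree_X_sub_C]
      norm_num
    · intro x
      rw [eval_pow]
      positivity
  have hprod : ∏ a ∈ p.roots.toFinset, (X - C a) = p := by
    rw [Finset.prod, Multiset.toFinset_val, hnodup.dedup]
    exact (hsplit.eq_prod_roots_of_monic hp).symm
  refine ⟨p.roots.toFinset, ?_, ?_, ?_⟩
  · rw [Multiset.toFinset_card_of_nodup hnodup, ← hpq, hsplit.natDegree_eq_card_roots]
  · intro x hx
    exact orthogonal_root_mem hω0 hω hp ho (isRoot_of_mem_roots (Multiset.mem_toFinset.1 hx))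
  · rw [hprod, ← hdeg]
    exact ho

/-- Interpolatory quadrature at nodes whose nodal polynomial is orthogonal to the polynomials of
degree less than `d`. -/
theorem polyIntegral_eq_sum {S : Finset ℝ} {d : ℕ}
    (ho : ∀ r : ℝ[X], r.degree < d → polyIntegral ((∏ a ∈ S, (X - C a)) * r) = 0) {f : ℝ[X]}
    (hf : f.natDegree < S.card + d) :
    polyIntegral f = ∑ x ∈ S, polyIntegral (Lagrange.basis S id x) * f.eval x := by
  set Q : ℝ[X] := ∏ a ∈ S, (X - C a) with hQ
  have hQm : Q.Monic := monic_prod_of_monic _ _ fun a _ => monic_X_sub_C a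
  have hQd : Q.natDegree = S.card := by
    rw [hQ, natDegree_prod_of_monic _ _ fun a _ => monic_X_sub_C a]
    simp
  have hQr : ∀ x ∈ S, Q.eval x = 0 := fun x hx => by
    rw [hQ, eval_prod]
    exact Finset.prod_eq_zero hx (by simp)
  -- The quotient by the nodal polynomial has degree below `d`, so its contribution integrates to
  -- zero; the remainder is its own Lagrange interpolant.
  have h1 : polyIntegral f = polyIntegral (f %ₘ Q) := by
    conv_lhs => rw [← modByMonic_add_div f Q]
    rw [map_add, add_eq_left]
    by_cases h0 : f /ₘ Q = 0
    · rw [h0, mul_zero, map_zero]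
    · apply ho
      rw [degree_eq_natDegree h0, natDegree_divByMonic f hQm, hQd]
      have hle : S.card ≤ f.natDegree := by
        by_contra! hlt
        refine h0 ((divByMonic_eq_zero_iff hQm).2 ?_)
        refine degree_lt_degree ?_
        rwa [hQd]
      norm_cast
      omega
  have h2 : f %ₘ Q = Lagrange.interpolate S id fun x => f.eval x := by
    refine Lagrange.eq_interpolate_of_eval_eq _ Function.injective_id.injOn ?_ ?_
    · rw [← hQd, ← degree_eq_natDegree hQm.ne_zero]
      exact degree_modByMonic_lt f hQm
    · intro x hx
      have := congrArg (eval x) (modByMonic_add_div f Q)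
      rw [eval_add, eval_mul, hQr x hx, zero_mul, add_zero] at this
      exact this
  rw [h1, h2, Lagrange.interpolate_apply, map_sum]
  refine Finset.sum_congr rfl fun x _ => ?_
  rw [← smul_eq_C_mul, map_smul, smul_eq_mul, mul_comm]

/-- A nonnegative test polynomial vanishing at all other nodes isolates the weight of `x`. -/
theorem quadrature_weight_pos {S : Finset ℝ} {w : ℝ → ℝ} {x : ℝ} (hx : x ∈ S)
    (hxI : x ∈ Set.Icc (-1 : ℝ) 1) {g : ℝ[X]} (hg0 : g ≠ 0)
    (hg : ∀ x ∈ Set.Icc (-1 : ℝ) 1, 0 ≤ g.eval x) (hgS : ∀ y ∈ S, y ≠ x → g.eval y = 0)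
    (hI : polyIntegral g = ∑ x ∈ S, w x * g.eval x) : 0 < w x := by
  rw [Finset.sum_eq_single_of_mem x hx fun y hy hyx => by rw [hgS y hy hyx, mul_zero]] at hI
  exact pos_of_mul_pos_left (hI ▸ polyIntegral_pos hg0 hg) (hg x hxI)

/-- Gauss quadrature for odd `N`, Gauss-Radau quadrature with the node `1` for even `N`. -/
theorem exists_quadrature (N : ℕ) : ∃ (S : Finset ℝ) (w : ℝ → ℝ),
    (∀ x ∈ S, x ∈ Set.Ioc (-1 : ℝ) 1) ∧ (∀ x ∈ S, 0 < w x) ∧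
    (∀ f : ℝ[X], f.natDegree ≤ N → polyIntegral f = ∑ x ∈ S, w x * f.eval x) ∧
    (2 * S.card = N + 1 ∨ 1 ∈ S ∧ 2 * S.card = N + 2) := by
  classical
  have hsq : ∀ T : Finset ℝ, ∀ x, 0 ≤ ((∏ a ∈ T, (X - C a)) ^ 2 : ℝ[X]).eval x := fun T x => by
    rw [eval_pow]
    positivity
  have hmon : ∀ T : Finset ℝ, (∏ a ∈ T, (X - C a) : ℝ[X]).Monic := fun T =>
    monic_prod_of_monic _ _ fun a _ => monic_X_sub_C a
  have hdeg : ∀ T : Finset ℝ, ((∏ a ∈ T, (X - C a)) ^ 2 : ℝ[X]).natDegree = 2 * T.card := by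
    intro T
    rw [natDegree_pow, natDegree_prod_of_monic _ _ fun a _ => monic_X_sub_C a]
    simp
  have hroot : ∀ T : Finset ℝ, ∀ y ∈ T, ((∏ a ∈ T, (X - C a)) ^ 2 : ℝ[X]).eval y = 0 := by
    intro T y hy
    rw [eval_pow, eval_prod, Finset.prod_eq_zero hy (by simp)]
    simp
  rcases Nat.even_or_odd' N with ⟨q, rfl | rfl⟩
  -- Radau case: with weight `1 - X`, adjoining the node `1` makes the full nodal polynomial
  -- orthogonal to degrees below `q` for the unweighted integral. With `q + 1` nodes the rule is
  -- exact up to degree `2q`.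
  · have hω0 : (1 - X : ℝ[X]) ≠ 0 := by
      rw [← neg_sub, neg_ne_zero]
      exact X_sub_C_ne_zero (1 : ℝ)
    have hω : ∀ x ∈ Set.Icc (-1 : ℝ) 1, 0 ≤ (1 - X : ℝ[X]).eval x := fun x hx => by
      simp only [eval_sub, eval_one, eval_X]
      linarith [hx.2]
    obtain ⟨S, hS, hSI, ho⟩ := exists_finset_orthogonal hω0 hω q
    have h1 : (1 : ℝ) ∉ S := fun h => lt_irrefl _ (hSI 1 h).2
    have hcard : (insert 1 S).card = q + 1 := by rw [Finset.card_insert_of_notMem h1, hS]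
    have ho' : ∀ r : ℝ[X], r.degree < q →
        polyIntegral ((∏ a ∈ insert 1 S, (X - C a)) * r) = 0 := by
      intro r hr
      have : (∏ a ∈ insert 1 S, (X - C a)) * r = -((∏ a ∈ S, (X - C a)) * r * (1 - X)) := by
        rw [Finset.prod_insert h1, C_1]
        ring
      rw [this, map_neg, ho r hr, neg_zero]
    obtain ⟨w, hI⟩ : ∃ w : ℝ → ℝ, ∀ f : ℝ[X], f.natDegree ≤ 2 * q → polyIntegral f =
        ∑ x ∈ insert 1 S, w x * f.eval x :=
      ⟨_, fun f hf => polyIntegral_eq_sum ho' (by omega)⟩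
    have hmem : ∀ x ∈ insert 1 S, x ∈ Set.Ioc (-1 : ℝ) 1 := by
      intro x hx
      rcases Finset.mem_insert.1 hx with rfl | hx
      · norm_num
      · exact ⟨(hSI x hx).1, (hSI x hx).2.le⟩
    refine ⟨insert 1 S, w, hmem, ?_, hI, Or.inr ⟨Finset.mem_insert_self _ _, by omega⟩⟩
    intro x hx
    have hxI := Set.Ioc_subset_Icc_self (hmem x hx)
    by_cases hx1 : x = 1
    · refine quadrature_weight_pos (g := (∏ a ∈ S, (X - C a)) ^ 2) hx hxI
        (pow_ne_zero _ (hmon S).ne_zero) (fun x _ => hsq S x) ?_ (hI _ ?_)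
      · intro y hy hyx
        exact hroot S y (Finset.mem_of_mem_insert_of_ne hy (by rwa [hx1] at hyx))
      · rw [hdeg, hS]
    · have hxS : x ∈ S := Finset.mem_of_mem_insert_of_ne hx hx1
      -- The factor `1 - X` kills the fixed node without losing nonnegativity; the degree is at most
      -- `2q - 1`.
      refine quadrature_weight_pos (g := (∏ a ∈ S.erase x, (X - C a)) ^ 2 * (1 - X)) hx hxI
        (mul_ne_zero (pow_ne_zero _ (hmon _).ne_zero) hω0) (fun x hx => ?_) ?_ (hI _ ?_)
      · rw [eval_mul]
        exact mul_nonneg (hsq _ x) (hω x hx)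
      · intro y hy hyx
        rw [eval_mul]
        rcases Finset.mem_insert.1 hy with rfl | hy
        · simp
        · rw [hroot _ y (Finset.mem_erase.2 ⟨hyx, hy⟩), zero_mul]
      · refine natDegree_mul_le.trans ?_
        have : (1 - X : ℝ[X]).natDegree ≤ 1 := by compute_degree
        rw [hdeg, Finset.card_erase_of_mem hxS]
        have := Finset.card_pos.2 ⟨x, hxS⟩
        omega
  · obtain ⟨S, hS, hSI, ho⟩ := exists_finset_orthogonal (ω := 1) one_ne_zero
      (fun x _ => by simp) (q + 1)
    obtain ⟨w, hI⟩ : ∃ w : ℝ → ℝ, ∀ f : ℝ[X], f.natDegree ≤ 2 * q + 1 → polyIntegral f =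
        ∑ x ∈ S, w x * f.eval x :=
      ⟨_, fun f hf => polyIntegral_eq_sum (d := q + 1) (fun r hr => by simpa using ho r hr) (by omega)⟩
    refine ⟨S, w, fun x hx => ⟨(hSI x hx).1, (hSI x hx).2.le⟩, ?_, hI, Or.inl (by omega)⟩
    intro x hx
    refine quadrature_weight_pos (g := (∏ a ∈ S.erase x, (X - C a)) ^ 2) hx
      (Set.Ioo_subset_Icc_self (hSI x hx))
        (pow_ne_zero _ (hmon _).ne_zero) (fun x _ => hsq _ x) ?_ (hI _ ?_)
    · intro y hy hyx
      exact hroot _ y (Finset.mem_erase.2 ⟨hyx, hy⟩)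
    · rw [hdeg, Finset.card_erase_of_mem hx]
      omega

end Quadrature

/-- The quadrature in the variable `θ = arccos x`. -/
theorem exists_isQuadrature (N : ℕ) : ∃ (Θ : Finset ℝ) (w : ℝ → ℝ), IsQuadrature N Θ w ∧
    (2 * Θ.card = N + 1 ∨ 0 ∈ Θ ∧ 2 * Θ.card = N + 2) := by
  classical
  obtain ⟨S, w, hS, hw, hI, hcard⟩ := exists_quadrature N
  have hinj : Set.InjOn Real.arccos S := fun x hx y hy h =>
    Real.arccos_injOn ⟨(hS x hx).1.le, (hS x hx).2⟩ ⟨(hS y hy).1.le, (hS y hy).2⟩ h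
  have hcos : ∀ x ∈ S, Real.cos (Real.arccos x) = x := fun x hx =>
    Real.cos_arccos (hS x hx).1.le (hS x hx).2
  refine ⟨S.image Real.arccos, fun θ => w (Real.cos θ), ⟨?_, ?_, ?_⟩, ?_⟩
  · intro θ hθ
    obtain ⟨x, hx, rfl⟩ := Finset.mem_image.1 hθ
    refine ⟨Real.arccos_nonneg x, lt_of_le_of_ne (Real.arccos_le_pi x) fun h => ?_⟩
    exact absurd (Real.arccos_eq_pi.1 h) (not_le.2 (hS x hx).1)
  · intro θ hθ
    obtain ⟨x, hx, rfl⟩ := Finset.mem_image.1 hθ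
    rw [hcos x hx]
    exact hw x hx
  · intro f hf
    rw [Finset.sum_image hinj]
    refine (hI f hf).trans (Finset.sum_congr rfl fun x hx => ?_)
    rw [hcos x hx]
  · rw [Finset.card_image_of_injOn hinj]
    refine hcard.imp id fun h => ⟨Finset.mem_image.2 ⟨1, h.1, Real.arccos_one⟩, h.2⟩

/-! ### The exact design from a quadrature grid -/

theorem integral_pow_mul_one_sub_pow (p q : ℕ) :
    ∫ x in (0 : ℝ)..1, x ^ p * (1 - x) ^ q =
      (p.factorial : ℝ) * q.factorial / (p + q + 1).factorial := by
  have h := Complex.Gamma_mul_Gamma_eq_betaIntegral (s := (p : ℂ) + 1) (t := (q : ℂ) + 1)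
    (by simp; positivity) (by simp; positivity)
  have hs : (p : ℂ) + 1 + ((q : ℂ) + 1) = ((p + q + 1 : ℕ) : ℂ) + 1 := by push_cast; ring
  rw [hs, Complex.Gamma_nat_eq_factorial, Complex.Gamma_nat_eq_factorial,
    Complex.Gamma_nat_eq_factorial, Complex.betaIntegral] at h
  simp only [add_sub_cancel_right, Complex.cpow_natCast] at h
  have hi : ∫ x in (0 : ℝ)..1, (x : ℂ) ^ p * (1 - (x : ℂ)) ^ q =
      ((∫ x in (0 : ℝ)..1, x ^ p * (1 - x) ^ q : ℝ) : ℂ) := by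
    rw [← intervalIntegral.integral_ofReal]
    push_cast
    rfl
  rw [hi] at h
  have h0 : ((p + q + 1).factorial : ℝ) ≠ 0 := Nat.cast_ne_zero.2 (Nat.factorial_ne_zero _)
  rw [eq_div_iff h0, mul_comm]
  exact_mod_cast h.symm

open Polynomial in
-- With `x = cos θ` the squares of the half-angle cosine and sine are `(1 ± x) / 2`. The summand is
-- thus a polynomial of degree at most `N` in `x`, and its integral is twice a Beta integral.
theorem IsQuadrature.sum_cos_sin {N : ℕ} {Θ : Finset ℝ} {w : ℝ → ℝ} (h : IsQuadrature N Θ w)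
    {p : ℕ} (hp : p ≤ N) :
    ∑ θ ∈ Θ, w θ * ((Real.cos (θ / 2) ^ 2) ^ (N - p) * (Real.sin (θ / 2) ^ 2) ^ p) =
      2 / (((N : ℝ) + 1) * N.choose p) := by
  set f : ℝ[X] := (C (1 / 2) * (1 + X)) ^ (N - p) * (C (1 / 2) * (1 - X)) ^ p with hf
  have hd : f.natDegree ≤ N := by
    have h1 : (C (1 / 2) * (1 + X) : ℝ[X]).natDegree ≤ 1 := by compute_degree
    have h2 : (C (1 / 2) * (1 - X) : ℝ[X]).natDegree ≤ 1 := by compute_degree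
    calc f.natDegree ≤ (N - p) * 1 + p * 1 :=
          natDegree_mul_le_of_le (natDegree_pow_le_of_le _ h1) (natDegree_pow_le_of_le _ h2)
      _ = N := by omega
  have he := h.exact f hd
  have hev : ∀ x, f.eval x = ((1 + x) / 2) ^ (N - p) * ((1 - x) / 2) ^ p := fun x => by
    simp only [hf, eval_mul, eval_pow, eval_C, eval_add, eval_sub, eval_one, eval_X]
    congr 1 <;> ring
  have hcos : ∀ θ : ℝ, f.eval (Real.cos θ) =
      (Real.cos (θ / 2) ^ 2) ^ (N - p) * (Real.sin (θ / 2) ^ 2) ^ p := fun θ => by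
    have h1 : Real.cos θ = 2 * Real.cos (θ / 2) ^ 2 - 1 := by
      rw [← Real.cos_two_mul]; congr 1; ring
    have h2 := Real.sin_sq_add_cos_sq (θ / 2)
    rw [hev]
    congr 2 <;> linarith
  rw [Finset.sum_congr rfl fun θ _ => by rw [hcos θ]] at he
  rw [← he]
  have hint : ∫ x in (-1 : ℝ)..1, f.eval x =
      2 * ∫ x in (0 : ℝ)..1, x ^ (N - p) * (1 - x) ^ p := by
    have := intervalIntegral.integral_comp_mul_add (a := (-1 : ℝ)) (b := 1)
      (fun x : ℝ => x ^ (N - p) * (1 - x) ^ p) (c := 1 / 2) (by norm_num) (1 / 2)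
    norm_num at this
    rw [← this]
    congr 1
    ext x
    rw [hev]
    congr 2 <;> ring
  rw [hint, integral_pow_mul_one_sub_pow, Nat.cast_choose ℝ hp, Nat.sub_add_cancel hp,
    Nat.factorial_succ]
  have h0 : (N.factorial : ℝ) ≠ 0 := Nat.cast_ne_zero.2 (Nat.factorial_ne_zero _)
  have h1 : (p.factorial : ℝ) ≠ 0 := Nat.cast_ne_zero.2 (Nat.factorial_ne_zero _)
  have h2 : ((N - p).factorial : ℝ) ≠ 0 := Nat.cast_ne_zero.2 (Nat.factorial_ne_zero _)
  have h3 : (N : ℝ) + 1 ≠ 0 := by positivity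
  push_cast
  field_simp

/-- Orthogonality of the characters of `ℤ/(N+1)`; distinct indices at most `N` stay distinct modulo
`N + 1`. -/
theorem sum_gridAngle (N : ℕ) (p q : Fin (N + 1)) :
    ∑ k : Fin (N + 1), Complex.exp (-(gridAngle N k * Complex.I)) ^ (p : ℕ) *
      star (Complex.exp (-(gridAngle N k * Complex.I)) ^ (q : ℕ)) =
        if p = q then (N : ℂ) + 1 else 0 := by
  set ξ := Complex.exp (2 * Real.pi * Complex.I / ((N + 1 : ℕ) : ℂ)) with hξ
  have hprim : IsPrimitiveRoot ξ (N + 1) := Complex.isPrimitiveRoot_exp _ (Nat.succ_ne_zero N)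
  have hξ0 : ξ ≠ 0 := Complex.exp_ne_zero _
  have hk : ∀ k : Fin (N + 1), Complex.exp (gridAngle N k * Complex.I) = ξ ^ (k : ℕ) := by
    intro k
    rw [hξ, ← Complex.exp_nat_mul, gridAngle]
    congr 1
    push_cast
    ring
  have hterm : ∀ k : Fin (N + 1), Complex.exp (-(gridAngle N k * Complex.I)) ^ (p : ℕ) *
      star (Complex.exp (-(gridAngle N k * Complex.I)) ^ (q : ℕ)) =
        (ξ ^ (q : ℕ) / ξ ^ (p : ℕ)) ^ (k : ℕ) := by
    intro k
    have : star (Complex.exp (-(gridAngle N k * Complex.I))) =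
        Complex.exp (gridAngle N k * Complex.I) := by
      rw [Complex.star_def, ← Complex.exp_conj]
      simp
    rw [star_pow, this, Complex.exp_neg, hk, div_pow, div_eq_mul_inv, inv_pow, ← pow_mul,
      ← pow_mul, ← pow_mul, ← pow_mul, mul_comm (k : ℕ), mul_comm (k : ℕ), mul_comm]
  rw [Finset.sum_congr rfl fun k _ => hterm k,
    ← Finset.sum_range (fun k => (ξ ^ (q : ℕ) / ξ ^ (p : ℕ)) ^ k)]
  split_ifs with h
  · subst h
    rw [div_self (pow_ne_zero _ hξ0)]
    simp
  · have hr : ξ ^ (q : ℕ) / ξ ^ (p : ℕ) ≠ 1 := by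
      rw [Ne, div_eq_one_iff_eq (pow_ne_zero _ hξ0)]
      exact fun he => h (Fin.ext (hprim.pow_inj q.2 p.2 he).symm)
    rw [geom_sum_eq hr, div_pow, ← pow_mul, ← pow_mul, mul_comm (q : ℕ), mul_comm (p : ℕ), pow_mul,
      pow_mul, hprim.pow_eq_one]
    simp

/-- The design property for a single spin `N/2`: azimuths kill the off-diagonal entries, and the
quadrature makes every diagonal entry `1/(N+1)`. -/
theorem IsQuadrature.sum_ketbra {N : ℕ} {Θ : Finset ℝ} {w : ℝ → ℝ} (h : IsQuadrature N Θ w) :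
    ∑ a ∈ Θ ×ˢ (Finset.univ : Finset (Fin (N + 1))),
      ((w a.1 / 2 * (1 / ((N : ℝ) + 1)) : ℝ) : ℂ) • ketbra (cvec N (Real.cos (a.1 / 2))
        (Complex.exp (-(gridAngle N a.2 * Complex.I)) * Real.sin (a.1 / 2))) =
      (1 / ((N : ℂ) + 1)) • (1 : Matrix (Fin (N + 1)) (Fin (N + 1)) ℂ) := by
  ext p q
  have hN : (N : ℂ) + 1 ≠ 0 := by exact_mod_cast Nat.succ_ne_zero N
  rw [Finset.sum_product, Matrix.sum_apply]
  simp only [Matrix.sum_apply, Matrix.smul_apply, smul_eq_mul, ketbra, Matrix.vecMulVec_apply,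
    Pi.star_apply]
  have hθ : ∀ θ : ℝ, ∑ k : Fin (N + 1), ((w θ / 2 * (1 / ((N : ℝ) + 1)) : ℝ) : ℂ) *
      (cvec N (Real.cos (θ / 2))
        (Complex.exp (-(gridAngle N k * Complex.I)) * Real.sin (θ / 2)) p *
      star (cvec N (Real.cos (θ / 2))
        (Complex.exp (-(gridAngle N k * Complex.I)) * Real.sin (θ / 2)) q)) =
      if p = q then (((N.choose p : ℝ) / 2 * (w θ * ((Real.cos (θ / 2) ^ 2) ^ (N - p) *
        (Real.sin (θ / 2) ^ 2) ^ (p : ℕ))) : ℝ) : ℂ) else 0 := by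
    intro θ
    have hk : ∀ k : Fin (N + 1), ((w θ / 2 * (1 / ((N : ℝ) + 1)) : ℝ) : ℂ) *
      (cvec N (Real.cos (θ / 2))
        (Complex.exp (-(gridAngle N k * Complex.I)) * Real.sin (θ / 2)) p *
      star (cvec N (Real.cos (θ / 2))
        (Complex.exp (-(gridAngle N k * Complex.I)) * Real.sin (θ / 2)) q)) =
      ((w θ / 2 * (1 / ((N : ℝ) + 1)) * (Real.sqrt (N.choose p) * Real.sqrt (N.choose q) *
        (Real.cos (θ / 2) ^ (N - p) * Real.cos (θ / 2) ^ (N - q) *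
        (Real.sin (θ / 2) ^ (p : ℕ) * Real.sin (θ / 2) ^ (q : ℕ)))) : ℝ) : ℂ) *
        (Complex.exp (-(gridAngle N k * Complex.I)) ^ (p : ℕ) *
      star (Complex.exp (-(gridAngle N k * Complex.I)) ^ (q : ℕ))) := by
      intro k
      simp only [cvec, star_mul', star_pow, Complex.star_def, Complex.conj_ofReal, mul_pow]
      push_cast
      ring
    rw [Finset.sum_congr rfl fun k _ => hk k, ← Finset.mul_sum, sum_gridAngle]
    split_ifs with hpq
    · subst hpq
      have hN' : (N : ℝ) + 1 ≠ 0 := by positivity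
      rw [Real.mul_self_sqrt (Nat.cast_nonneg _)]
      have : (N : ℂ) + 1 = (((N : ℝ) + 1 : ℝ) : ℂ) := by push_cast; rfl
      rw [this, ← Complex.ofReal_mul]
      congr 1
      field_simp
      ring
    · rw [mul_zero]
  rw [Finset.sum_congr rfl fun θ _ => hθ θ]
  split_ifs with hpq
  · subst hpq
    rw [← Complex.ofReal_sum, ← Finset.mul_sum, h.sum_cos_sin (Nat.lt_succ_iff.1 p.2),
      Matrix.one_apply_eq]
    have hc : (N.choose p : ℂ) ≠ 0 :=
      Nat.cast_ne_zero.2 (Nat.choose_pos (Nat.lt_succ_iff.1 p.2)).ne'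
    push_cast
    field_simp
  · rw [Matrix.one_apply_ne hpq]
    simp

/-- Lets sums over the set of states be computed over the grid itself, whether or not grid states
coincide. -/
theorem sum_gridWeight_smul {M : Type*} [AddCommGroup M] [Module ℂ M] (t N : ℕ) (Θ : Finset ℝ)
    (w : ℝ → ℝ) (F : (Fin (t + 1) → ℂ) → M) :
    ∑ ψ ∈ gridSet t N Θ, (gridWeight t N Θ w ψ : ℂ) • F ψ =
      ∑ a ∈ Θ ×ˢ (Finset.univ : Finset (Fin (N + 1))),
        ((w a.1 / 2 * (1 / ((N : ℝ) + 1)) : ℝ) : ℂ) • F (coherent t a.1 (gridAngle N a.2)) := by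
  classical
  simp only [gridWeight, Complex.ofReal_sum, Finset.sum_smul]
  rw [Finset.sum_comm]
  refine Finset.sum_congr rfl fun a ha => ?_
  have hmem : coherent t a.1 (gridAngle N a.2) ∈ gridSet t N Θ := by
    rw [gridSet]
    exact Finset.mem_image.2 ⟨a, ha, rfl⟩
  rw [Finset.sum_eq_single_of_mem _ hmem]
  · rw [if_pos rfl]
  · intro ψ _ hψ
    rw [if_neg hψ.symm, Complex.ofReal_zero, zero_smul]

theorem rhoW_grid {t n : ℕ} {Θ : Finset ℝ} {w : ℝ → ℝ} (h : IsQuadrature (n * t) Θ w) :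
    rhoW n (gridSet t (n * t) Θ) (gridWeight t (n * t) Θ w) = rhoZero t n := by
  rw [rhoW, sum_gridWeight_smul]
  simp only [coherent_eq_cvec, copies_cvec]
  have := congrArg (fun M => spinIsometry t n * M * (spinIsometry t n)ᴴ) h.sum_ketbra
  simp only [Matrix.mul_sum, Matrix.sum_mul, Matrix.mul_smul, Matrix.smul_mul, Matrix.mul_one] at this
  rw [this, rhoZero, spinProj_eq]
  push_cast
  rfl

theorem isWeightedSet_grid {t N : ℕ} {Θ : Finset ℝ} {w : ℝ → ℝ} (h : IsQuadrature N Θ w) :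
    IsWeightedSet (gridSet t N Θ) (gridWeight t N Θ w) where
  coherent φ hφ := by
    rw [gridSet, Finset.mem_image] at hφ
    obtain ⟨a, ha, rfl⟩ := hφ
    have hθ := h.mem a.1 (Finset.mem_product.1 ha).1
    refine ⟨_, ⟨a.1, ⟨hθ.1, hθ.2.le⟩, gridAngle N a.2, ⟨?_, ?_⟩, 0, ⟨le_rfl, Real.two_pi_pos⟩, 0,
      ⟨le_rfl, Real.two_pi_pos⟩, rfl⟩, rfl⟩
    · rw [gridAngle]
      have := Real.pi_pos
      positivity
    · rw [gridAngle, div_lt_iff₀ (by positivity)]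
      have h1 : ((a.2 : ℕ) : ℝ) < (N : ℝ) + 1 := by exact_mod_cast a.2.2
      exact mul_lt_mul_of_pos_left h1 Real.two_pi_pos
  nonneg φ _ := by
    refine Finset.sum_nonneg fun a ha => ?_
    have := (h.pos a.1 (Finset.mem_product.1 ha).1).le
    split_ifs
    · positivity
    · exact le_rfl
  sum_eq_one := by
    have h1 := sum_gridWeight_smul t N Θ w (fun _ => (1 : ℂ))
    have h2 := h.exact 1 (by simp)
    simp only [smul_eq_mul, mul_one, Finset.sum_product, Finset.sum_const, Finset.card_univ,
      Fintype.card_fin, nsmul_eq_mul] at h1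
    have h3 : ∑ θ ∈ Θ, w θ = 2 := by
      norm_num at h2
      exact h2.symm
    have hN : ((N + 1 : ℕ) : ℝ) ≠ 0 := by positivity
    have h4 : ∑ ψ ∈ gridSet t N Θ, gridWeight t N Θ w ψ =
        ∑ θ ∈ Θ, ((N + 1 : ℕ) : ℝ) * (w θ / 2 * (1 / ((N : ℝ) + 1))) := by exact_mod_cast h1
    rw [h4, ← Finset.mul_sum, ← Finset.sum_mul, ← Finset.sum_div, h3]
    push_cast at hN ⊢
    field_simp

theorem coherent_zero (t : ℕ) (φ : ℝ) : coherent t 0 φ = lowest t := by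
  rw [coherent_eq_cvec, lowest_eq_cvec]
  simp

/-- In the Radau case the `N + 1` grid points with `θ = 0` collapse to `lowest t`, leaving at most
`(N/2)(N+1) + 1` states. This is within the bound exactly when `N ≥ 1`. -/
theorem gridSet_card_le {t N : ℕ} (hN : 1 ≤ N) {Θ : Finset ℝ}
    (h : 2 * Θ.card = N + 1 ∨ 0 ∈ Θ ∧ 2 * Θ.card = N + 2) :
    ((gridSet t N Θ).card : ℝ) ≤ ((N : ℝ) + 1) ^ 2 / 2 := by
  classical
  rw [le_div_iff₀ two_pos]
  suffices hc : (gridSet t N Θ).card * 2 ≤ (N + 1) ^ 2 by exact_mod_cast hc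
  rcases h with h | ⟨h0, h⟩
  · have : (gridSet t N Θ).card ≤ Θ.card * (N + 1) := by
      rw [gridSet]
      refine Finset.card_image_le.trans ?_
      simp
    calc (gridSet t N Θ).card * 2 ≤ Θ.card * (N + 1) * 2 := Nat.mul_le_mul_right _ this
      _ = (2 * Θ.card) * (N + 1) := by ring
      _ = (N + 1) ^ 2 := by rw [h]; ring
  · have hsub : gridSet t N Θ ⊆ insert (lowest t)
        (((Θ.erase 0) ×ˢ (Finset.univ : Finset (Fin (N + 1)))).image
          fun a => coherent t a.1 (gridAngle N a.2)) := by
      intro ψ hψ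
      rw [gridSet, Finset.mem_image] at hψ
      obtain ⟨⟨θ, k⟩, ha, rfl⟩ := hψ
      by_cases hθ : θ = 0
      · exact Finset.mem_insert.2 (Or.inl (by rw [hθ]; exact coherent_zero t _))
      · exact Finset.mem_insert_of_mem (Finset.mem_image.2 ⟨(θ, k), Finset.mem_product.2
          ⟨Finset.mem_erase.2 ⟨hθ, (Finset.mem_product.1 ha).1⟩, Finset.mem_univ _⟩, rfl⟩)
    have : (gridSet t N Θ).card ≤ (Θ.card - 1) * (N + 1) + 1 := by
      refine (Finset.card_le_card hsub).trans ((Finset.card_insert_le _ _).trans ?_)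
      refine Nat.add_le_add_right (Finset.card_image_le.trans ?_) _
      simp [Finset.card_erase_of_mem h0]
    calc (gridSet t N Θ).card * 2 ≤ ((Θ.card - 1) * (N + 1) + 1) * 2 := Nat.mul_le_mul_right _ this
      _ = (2 * (Θ.card - 1)) * (N + 1) + 2 := by ring
      _ = N * (N + 1) + 2 := by congr 2; omega
      _ ≤ (N + 1) ^ 2 := by nlinarith

/-! ### Fidelity with a pure state -/

section Fidelity

variable {ι : Type*} [Fintype ι]

theorem ketbra_posSemidef (v : ι → ℂ) : (ketbra v).PosSemidef :=
  Matrix.posSemidef_vecMulVec_self_star v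

theorem ketbra_mul_mul_ketbra (v : ι → ℂ) (M : Matrix ι ι ℂ) :
    ketbra v * M * ketbra v = (star v ⬝ᵥ M *ᵥ v) • ketbra v := by
  rw [ketbra, Matrix.vecMulVec_mul, Matrix.vecMulVec_mul_vecMulVec, ← Matrix.dotProduct_mulVec]
  ext i j
  simp only [Matrix.vecMulVec_apply, Matrix.smul_apply, Pi.smul_apply, smul_eq_mul]
  ring

theorem trace_mul_ketbra (v : ι → ℂ) (M : Matrix ι ι ℂ) :
    (M * ketbra v).trace = star v ⬝ᵥ M *ᵥ v := by
  rw [ketbra, Matrix.mul_vecMulVec, Matrix.trace_vecMulVec, dotProduct_comm]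

theorem trace_mul_ketbra_nonneg (v : ι → ℂ) {M : Matrix ι ι ℂ} (hM : M.PosSemidef) :
    0 ≤ (M * ketbra v).trace := by
  rw [trace_mul_ketbra]
  exact hM.dotProduct_mulVec_nonneg v

variable [DecidableEq ι]

/-- The fidelity with a pure state is the expectation value of its projector. -/
theorem fidelity_ketbra {ρ : Matrix ι ι ℂ} (hρ : ρ.PosSemidef) {v : ι → ℂ}
    (hv : (ketbra v).trace = 1) : fidelity ρ (ketbra v) = (ρ * ketbra v).trace.re := by
  have hQ : 0 ≤ ketbra v := Matrix.nonneg_iff_posSemidef.2 (ketbra_posSemidef v)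
  have hρ0 : 0 ≤ ρ := Matrix.nonneg_iff_posSemidef.2 hρ
  have hQh : star (ketbra v) = ketbra v := (ketbra_posSemidef v).isHermitian
  have hQQ : ketbra v * ketbra v = ketbra v := by
    have h := ketbra_mul_mul_ketbra v 1
    rwa [Matrix.mul_one, ← trace_mul_ketbra, Matrix.one_mul, hv, one_smul] at h
  have hsQ : CFC.sqrt (ketbra v) = ketbra v := CFC.sqrt_unique hQQ hQ
  have hc0 := trace_mul_ketbra_nonneg v hρ
  set c := (ρ * ketbra v).trace with hc
  have hcr : c = (c.re : ℂ) := Complex.eq_re_of_ofReal_le hc0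
  have hcre : 0 ≤ c.re := (Complex.le_def.1 hc0).1
  -- With `Q = |v⟩⟨v|`, `(√ρ Q)† (√ρ Q) = Q ρ Q = c Q`, whose positive square root is `√c Q`.
  have hsq : CFC.abs (CFC.sqrt ρ * ketbra v) = ((Real.sqrt c.re : ℝ) : ℂ) • ketbra v := by
    rw [CFC.abs]
    apply CFC.sqrt_unique
    · have hsρ : star (CFC.sqrt ρ) = CFC.sqrt ρ :=
        (IsSelfAdjoint.of_nonneg (CFC.sqrt_nonneg ρ)).star_eq
      rw [star_mul, hQh, hsρ, Matrix.mul_assoc, ← Matrix.mul_assoc (CFC.sqrt ρ),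
        CFC.sqrt_mul_sqrt_self ρ hρ0, ← Matrix.mul_assoc, ketbra_mul_mul_ketbra, ← trace_mul_ketbra,
        Matrix.smul_mul, Matrix.mul_smul, smul_smul, hQQ, ← Complex.ofReal_mul,
        Real.mul_self_sqrt hcre, ← hcr]
    · exact Matrix.nonneg_iff_posSemidef.2 ((ketbra_posSemidef v).smul
        (by exact_mod_cast Real.sqrt_nonneg _))
  rw [fidelity, hsQ, hsq, Matrix.trace_smul, hv, smul_eq_mul, mul_one, Complex.ofReal_re,
    Real.sq_sqrt hcre]

end Fidelity

theorem fidelity_nonneg {ι : Type*} [Fintype ι] [DecidableEq ι] (ρ σ : Matrix ι ι ℂ) :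
    0 ≤ fidelity ρ σ := sq_nonneg _

theorem worstFidelity_le {t n m : ℕ} (R : Op t n → Op t m) {ψ : Fin (t + 1) → ℂ}
    (hψ : ψ ∈ coherentStates t) :
    worstFidelity R ≤ fidelity (R (copies n ψ)) (copies m ψ) :=
  ciInf_le ⟨0, by rintro _ ⟨_, rfl⟩; exact fidelity_nonneg _ _⟩ (⟨ψ, hψ⟩ : coherentStates t)

/-- Besides giving the second half of the theorem, this design expresses `spinProj` through coherent
states and averages over targets in the fidelity bound. -/
theorem exists_design {t n : ℕ} (ht : 1 ≤ t) (hn : 1 ≤ n) :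
    ∃ (Θ : Finset ℝ) (w : ℝ → ℝ), IsQuadrature (n * t) Θ w ∧
      IsWeightedSet (gridSet t (n * t) Θ) (gridWeight t (n * t) Θ w) ∧
      rhoW n (gridSet t (n * t) Θ) (gridWeight t (n * t) Θ w) = rhoZero t n ∧
      ((gridSet t (n * t) Θ).card : ℝ) ≤ ((n : ℝ) * t + 1) ^ 2 / 2 := by
  obtain ⟨Θ, w, h, hc⟩ := exists_isQuadrature (n * t)
  refine ⟨Θ, w, h, isWeightedSet_grid h, rhoW_grid h, ?_⟩
  have := gridSet_card_le (t := t) (Nat.mul_pos hn ht) hc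
  push_cast at this
  exact this

theorem coe_ne_zero (t n : ℕ) : (n : ℂ) * t + 1 ≠ 0 := by
  exact_mod_cast Nat.succ_ne_zero (n * t)

theorem rhoZero_trace (t n : ℕ) : (rhoZero t n).trace = 1 := by
  rw [rhoZero, Matrix.trace_smul, spinProj_trace, smul_eq_mul, one_div,
    inv_mul_cancel₀ (coe_ne_zero t n)]

/-! ### Collective rotations -/

/-- The operator `V^{⊗ n}`. -/
noncomputable def tensorOp {t : ℕ} (n : ℕ) (V : Matrix (Fin (t + 1)) (Fin (t + 1)) ℂ) : Op t n :=
  fun x y => ∏ l, V (x l) (y l)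

theorem tensorOp_mulVec {t : ℕ} (n : ℕ) (V : Matrix (Fin (t + 1)) (Fin (t + 1)) ℂ)
    (ψ : Fin (t + 1) → ℂ) : tensorOp n V *ᵥ tensorVec n ψ = tensorVec n (V *ᵥ ψ) := by
  ext x
  simp only [Matrix.mulVec, dotProduct, tensorOp, tensorVec]
  rw [Fintype.prod_sum]
  exact Finset.sum_congr rfl fun y _ => Finset.prod_mul_distrib.symm

theorem tensorOp_conjTranspose_mul_self {t : ℕ} (n : ℕ) {V : Matrix (Fin (t + 1)) (Fin (t + 1)) ℂ}
    (hV : Vᴴ * V = 1) : (tensorOp n V)ᴴ * tensorOp n V = 1 := by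
  ext x y
  have h : ((tensorOp n V)ᴴ * tensorOp n V) x y = ∏ l, (Vᴴ * V) (x l) (y l) := by
    simp only [Matrix.mul_apply, Matrix.conjTranspose_apply, tensorOp, star_prod]
    rw [Fintype.prod_sum]
    exact Finset.sum_congr rfl fun y _ => Finset.prod_mul_distrib.symm
  rw [h, hV]
  by_cases hxy : x = y
  · subst hxy
    simp
  · rw [Matrix.one_apply_ne hxy]
    obtain ⟨l, hl⟩ := Function.ne_iff.1 hxy
    exact Finset.prod_eq_zero (Finset.mem_univ l) (Matrix.one_apply_ne hl)

theorem copies_mulVec {t : ℕ} (n : ℕ) (V : Matrix (Fin (t + 1)) (Fin (t + 1)) ℂ)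
    (ψ : Fin (t + 1) → ℂ) :
    copies n (V *ᵥ ψ) = tensorOp n V * copies n ψ * (tensorOp n V)ᴴ := by
  rw [copies, copies, ← tensorOp_mulVec, ketbra, ketbra, Matrix.star_mulVec, Matrix.mul_vecMulVec,
    Matrix.vecMulVec_mul]

theorem rotationGroup_conjTranspose_mul_self {t : ℕ} {V : Matrix (Fin (t + 1)) (Fin (t + 1)) ℂ}
    (hV : V ∈ rotationGroup t) : Vᴴ * V = 1 := by
  obtain ⟨θ, -, φ, -, z, -, γ, -, rfl⟩ := hV
  exact rotation_conjTranspose_mul_self t θ φ z γ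

/-- Two orthogonal projections `P`, `Q` of the same trace with `P Q = Q` are equal. -/
theorem projection_eq_of_trace_eq {ι : Type*} [Fintype ι] {P Q : Matrix ι ι ℂ} (hP : Pᴴ = P)
    (hQ : Qᴴ = Q) (hPP : P * P = P) (hQQ : Q * Q = Q) (hPQ : P * Q = Q) (htr : P.trace = Q.trace) :
    P = Q := by
  have hQP : Q * P = Q := by
    have := congrArg Matrix.conjTranspose hPQ
    rwa [Matrix.conjTranspose_mul, hP, hQ] at this
  -- Here `(P - Q)† (P - Q) = P - Q`, which has trace zero.
  rw [← sub_eq_zero, ← Matrix.trace_conjTranspose_mul_self_eq_zero_iff, Matrix.conjTranspose_sub,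
    hP, hQ, Matrix.sub_mul, Matrix.mul_sub, Matrix.mul_sub, hPP, hPQ, hQP, hQQ, sub_self, sub_zero,
    Matrix.trace_sub, htr, sub_self]

/-- Collective rotations preserve the subspace of maximal total spin. -/
theorem tensorOp_conj_spinProj {t n : ℕ} (ht : 1 ≤ t) (hn : 1 ≤ n)
    {V : Matrix (Fin (t + 1)) (Fin (t + 1)) ℂ} (hV : V ∈ rotationGroup t) :
    tensorOp n V * spinProj t n * (tensorOp n V)ᴴ = spinProj t n := by
  have hA := tensorOp_conjTranspose_mul_self n (rotationGroup_conjTranspose_mul_self hV)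
  set A := tensorOp n V with hAdef
  obtain ⟨Θ, w, -, hW, hρ, -⟩ := exists_design ht hn
  set W := gridSet t (n * t) Θ
  set p := gridWeight t (n * t) Θ w
  -- Writing the projection as a mixture of coherent copies makes its conjugate a mixture of rotated
  -- coherent copies, all fixed by `spinProj`; equality of traces does the rest.
  have hP : spinProj t n = ((n : ℂ) * t + 1) • rhoW n W p := by
    rw [hρ, rhoZero, smul_smul, one_div, mul_inv_cancel₀ (coe_ne_zero t n), one_smul]
  have hconj : A * spinProj t n * Aᴴ =
      ((n : ℂ) * t + 1) • ∑ φ ∈ W, (p φ : ℂ) • copies n (V *ᵥ φ) := by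
    rw [hP, rhoW, Matrix.mul_smul, Matrix.smul_mul, Matrix.mul_sum, Matrix.sum_mul]
    congr 1
    exact Finset.sum_congr rfl fun φ _ => by
      rw [Matrix.mul_smul, Matrix.smul_mul, copies_mulVec]
  symm
  refine projection_eq_of_trace_eq (spinProj_conjTranspose t n) ?_ (spinProj_mul_self t n) ?_ ?_ ?_
  · rw [Matrix.conjTranspose_mul, Matrix.conjTranspose_mul, Matrix.conjTranspose_conjTranspose,
      spinProj_conjTranspose, Matrix.mul_assoc]
  · calc A * spinProj t n * Aᴴ * (A * spinProj t n * Aᴴ) =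
          A * spinProj t n * (Aᴴ * A) * spinProj t n * Aᴴ := by simp only [Matrix.mul_assoc]
      _ = A * spinProj t n * Aᴴ := by
          rw [hA, Matrix.mul_one, Matrix.mul_assoc A, spinProj_mul_self]
  · rw [hconj, Matrix.mul_smul, Matrix.mul_sum]
    congr 1
    refine Finset.sum_congr rfl fun φ hφ => ?_
    obtain ⟨ψ, hψ, h⟩ := exists_copies_mulVec_eq hV (hW.coherent φ hφ) n
    rw [Matrix.mul_smul, h, spinProj_mul_copies n hψ]
  · rw [Matrix.trace_mul_comm, ← Matrix.mul_assoc, hA, Matrix.one_mul]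

/-! ### Alice's conditional states -/

theorem kronecker_mulVec_maxEntangled (t n : ℕ) (a b : Fin n → Fin (t + 1)) :
    (Matrix.kronecker (spinProj t n) (spinProj t n)ᵀ *ᵥ maxEntangled (Fin n → Fin (t + 1))) (a, b) =
      ((1 / Real.sqrt (Fintype.card (Fin n → Fin (t + 1))) : ℝ) : ℂ) * spinProj t n a b := by
  conv_rhs => rw [← spinProj_mul_self, Matrix.mul_apply, Finset.mul_sum]
  rw [Matrix.mulVec, dotProduct, Fintype.sum_prod_type]
  refine Finset.sum_congr rfl fun c _ => ?_
  rw [Finset.sum_eq_single c]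
  · simp only [Matrix.kronecker, Matrix.kroneckerMap_apply, maxEntangled, if_true,
      Matrix.transpose_apply]
    ring
  · intro d _ hd
    simp [maxEntangled, hd.symm]
  · simp

theorem sharedState_apply (t n : ℕ) (a b a' b' : Fin n → Fin (t + 1)) :
    sharedState t n (a, b) (a', b') =
      ((n : ℂ) * t + 1)⁻¹ * (spinProj t n a b * spinProj t n b' a') := by
  set c : ℂ := ((1 / Real.sqrt (Fintype.card (Fin n → Fin (t + 1))) : ℝ) : ℂ) with hc
  have hc0 : c ≠ 0 := by
    have : (0 : ℝ) < 1 / Real.sqrt (Fintype.card (Fin n → Fin (t + 1))) := by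
      have : (0 : ℝ) < Fintype.card (Fin n → Fin (t + 1)) := by exact_mod_cast Fintype.card_pos
      positivity
    exact Complex.ofReal_ne_zero.2 this.ne'
  have hcs : star c = c := by rw [hc, Complex.star_def, Complex.conj_ofReal]
  have hP : ∀ x y, star (spinProj t n x y) = spinProj t n y x := fun x y => by
    rw [← Matrix.conjTranspose_apply, spinProj_conjTranspose]
  have happ : ∀ a b a' b', afterSuccess t n (a, b) (a', b') =
      c ^ 2 * (spinProj t n a b * spinProj t n b' a') := by
    intro a b a' b'
    rw [afterSuccess, ketbra, Matrix.vecMulVec_apply, Pi.star_apply, kronecker_mulVec_maxEntangled,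
      kronecker_mulVec_maxEntangled, ← hc, star_mul', hcs, hP]
    ring
  have htr : (afterSuccess t n).trace = c ^ 2 * ((n : ℂ) * t + 1) := by
    rw [← spinProj_trace t n, Matrix.trace, Fintype.sum_prod_type, Matrix.trace, Finset.mul_sum]
    refine Finset.sum_congr rfl fun a _ => ?_
    rw [Matrix.diag_apply]
    conv_rhs => rw [← spinProj_mul_self, Matrix.mul_apply, Finset.mul_sum]
    exact Finset.sum_congr rfl fun b _ => happ a b a b
  rw [sharedState, Matrix.smul_apply, happ, htr, smul_eq_mul]
  field_simp

/-- The transpose trick: the shared vector has the entries of `spinProj` as amplitudes, so Bob's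
effect acts on Alice's side as its transpose. -/
theorem aliceUnnormalized_eq {t n : ℕ} (E : Op t n) :
    aliceUnnormalized E = ((n : ℂ) * t + 1)⁻¹ • (spinProj t n * Eᵀ * spinProj t n) := by
  ext a a'
  rw [aliceUnnormalized, traceB, Matrix.smul_apply, smul_eq_mul, Matrix.mul_apply, Finset.mul_sum]
  refine Finset.sum_congr rfl fun b _ => ?_
  rw [Matrix.mul_apply, Matrix.mul_apply, Fintype.sum_prod_type,
    Finset.sum_eq_single_of_mem a (Finset.mem_univ a), Finset.sum_mul, Finset.mul_sum]
  · refine Finset.sum_congr rfl fun b' _ => ?_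
    rw [sharedState_apply, Matrix.kronecker, Matrix.kroneckerMap_apply, Matrix.one_apply_eq,
      Matrix.transpose_apply]
    ring
  · intro d _ hd
    refine Finset.sum_eq_zero fun b' _ => ?_
    rw [Matrix.kronecker, Matrix.kroneckerMap_apply, Matrix.one_apply_ne hd.symm]
    simp

theorem spinProj_comp_perm {t n : ℕ} (π : Equiv.Perm (Fin n)) (x y : Fin n → Fin (t + 1)) :
    spinProj t n (x ∘ π) y = spinProj t n x y := by
  rw [spinProj_eq, Matrix.mul_apply, Matrix.mul_apply]
  refine Finset.sum_congr rfl fun k _ => ?_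
  rw [spinIsometry_apply, spinIsometry_apply]
  have h1 : excitation (x ∘ π) = excitation x := Equiv.sum_comp π fun l => (x l : ℕ)
  have h2 : ∏ l, Real.sqrt (t.choose ((x ∘ π) l)) = ∏ l, Real.sqrt (t.choose (x l)) :=
    Equiv.prod_comp π fun l => Real.sqrt (t.choose (x l))
  rw [h1, h2]

theorem aliceUnnormalized_comp_perm {t n : ℕ} (E : Op t n) (π : Equiv.Perm (Fin n))
    (x y : Fin n → Fin (t + 1)) :
    aliceUnnormalized E (x ∘ π) y = aliceUnnormalized E x y := by
  rw [aliceUnnormalized_eq, Matrix.mul_assoc, Matrix.smul_apply, Matrix.smul_apply,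
    Matrix.mul_apply, Matrix.mul_apply]
  simp only [spinProj_comp_perm]

theorem spinProj_mul_copies_mulVec {t : ℕ} (n : ℕ) {V : Matrix (Fin (t + 1)) (Fin (t + 1)) ℂ}
    (hV : V ∈ rotationGroup t) {φ : Fin (t + 1) → ℂ} (hφ : φ ∈ coherentStates t) :
    spinProj t n * copies n (V *ᵥ φ) * spinProj t n = copies n (V *ᵥ φ) := by
  obtain ⟨ψ, hψ, h⟩ := exists_copies_mulVec_eq hV hφ n
  rw [h, spinProj_mul_copies n hψ, copies_mul_spinProj n hψ]

theorem copies_mulVec_trace {t : ℕ} (n : ℕ) {V : Matrix (Fin (t + 1)) (Fin (t + 1)) ℂ}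
    (hV : V ∈ rotationGroup t) {φ : Fin (t + 1) → ℂ} (hφ : φ ∈ coherentStates t) :
    (copies n (V *ᵥ φ)).trace = 1 := by
  obtain ⟨ψ, hψ, h⟩ := exists_copies_mulVec_eq hV hφ n
  rw [h, copies_trace n hψ]

/-! ### Bob's outcomes and Alice's averaged output -/

section Protocol

variable {t n m : ℕ} {ε : ℝ} {W : Finset (Fin (t + 1) → ℂ)} {p : (Fin (t + 1) → ℂ) → ℝ}
  {V : Matrix (Fin (t + 1)) (Fin (t + 1)) ℂ} {R : Op t n → Op t m}

theorem aliceUnnormalized_bobEffect (hV : V ∈ rotationGroup t) {φ : Fin (t + 1) → ℂ}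
    (hφ : φ ∈ coherentStates t) :
    aliceUnnormalized (bobEffect n ε p V φ) =
      ((1 / (1 + ε) * p φ : ℝ) : ℂ) • copies n (V *ᵥ φ) := by
  have h0 := coe_ne_zero t n
  rw [aliceUnnormalized_eq, bobEffect, Matrix.transpose_smul, Matrix.transpose_transpose,
    Matrix.mul_smul, Matrix.smul_mul, spinProj_mul_copies_mulVec n hV hφ, smul_smul]
  congr 1
  rw [Complex.ofReal_mul _ ((n : ℝ) * t + 1)]
  push_cast
  field_simp

theorem outcomeProb_bobEffect (hV : V ∈ rotationGroup t) {φ : Fin (t + 1) → ℂ}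
    (hφ : φ ∈ coherentStates t) :
    outcomeProb (bobEffect n ε p V φ) = 1 / (1 + ε) * p φ := by
  rw [outcomeProb, aliceUnnormalized_bobEffect hV hφ, Matrix.trace_smul,
    copies_mulVec_trace n hV hφ, smul_eq_mul, mul_one, Complex.ofReal_re]

theorem outcomeProb_smul_bobEffect (hV : V ∈ rotationGroup t) {φ : Fin (t + 1) → ℂ}
    (hφ : φ ∈ coherentStates t) :
    (outcomeProb (bobEffect n ε p V φ) : ℂ) • R (aliceState (bobEffect n ε p V φ)) =
      ((1 / (1 + ε) * p φ : ℝ) : ℂ) • R (copies n (V *ᵥ φ)) := by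
  rw [aliceState, outcomeProb_bobEffect hV hφ, aliceUnnormalized_bobEffect hV hφ]
  -- At probability zero the conditional state is a default value on which `R` is uncontrolled, but
  -- its coefficient vanishes.
  by_cases h : 1 / (1 + ε) * p φ = 0
  · rw [h, Complex.ofReal_zero, zero_smul, zero_smul]
  · rw [smul_smul, inv_mul_cancel₀ (Complex.ofReal_ne_zero.2 h), one_smul]

/-- The residual operator is `(1 + ε)⁻¹ ((1 + ε) ρ₀ - ρ_W)` conjugated by `V^{⊗ n}`, since `ρ₀` is
invariant. Its positivity is the upper design inequality. -/
theorem aliceUnnormalized_bobResidual (ht : 1 ≤ t) (hn : 1 ≤ n) (hε : 0 ≤ ε)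
    (hW : IsWeightedSet W p) (hD : IsApproxDesign n ε W p) (hV : V ∈ rotationGroup t) :
    (aliceUnnormalized (bobResidual n ε W p V)).PosSemidef ∧
      (aliceUnnormalized (bobResidual n ε W p V)).trace = ((ε / (1 + ε) : ℝ) : ℂ) := by
  have h1 : (1 + ε) ≠ 0 := by positivity
  have heq : aliceUnnormalized (bobResidual n ε W p V) =
      rhoZero t n - ((1 / (1 + ε) : ℝ) : ℂ) • ∑ φ ∈ W, (p φ : ℂ) • copies n (V *ᵥ φ) := by
    have hlin : aliceUnnormalized (bobResidual n ε W p V) =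
        aliceUnnormalized (spinProj t n)ᵀ - ∑ φ ∈ W, aliceUnnormalized (bobEffect n ε p V φ) := by
      simp only [aliceUnnormalized_eq, bobResidual, Matrix.transpose_sub, Matrix.transpose_sum,
        Matrix.mul_sub, Matrix.sub_mul, Matrix.mul_sum, Matrix.sum_mul, smul_sub, Finset.smul_sum]
    rw [hlin, aliceUnnormalized_eq, Matrix.transpose_transpose, spinProj_mul_self,
      spinProj_mul_self, rhoZero, one_div, Finset.smul_sum]
    congr 1
    refine Finset.sum_congr rfl fun φ hφ => ?_
    rw [aliceUnnormalized_bobEffect hV (hW.coherent φ hφ), smul_smul, Complex.ofReal_mul]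
  constructor
  · have hconj := (Matrix.le_iff.1 hD.2).mul_mul_conjTranspose_same (tensorOp n V)
    have hz : tensorOp n V * rhoZero t n * (tensorOp n V)ᴴ = rhoZero t n := by
      rw [rhoZero, Matrix.mul_smul, Matrix.smul_mul, tensorOp_conj_spinProj ht hn hV]
    have hw : tensorOp n V * rhoW n W p * (tensorOp n V)ᴴ =
        ∑ φ ∈ W, (p φ : ℂ) • copies n (V *ᵥ φ) := by
      rw [rhoW, Matrix.mul_sum, Matrix.sum_mul]
      exact Finset.sum_congr rfl fun φ _ => by
        rw [Matrix.mul_smul, Matrix.smul_mul, copies_mulVec]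
    rw [Matrix.mul_sub, Matrix.sub_mul, Matrix.mul_smul, Matrix.smul_mul, hz, hw] at hconj
    have hs : (0 : ℂ) ≤ ((1 / (1 + ε) : ℝ) : ℂ) := by
      have : 0 ≤ 1 / (1 + ε) := by positivity
      exact_mod_cast this
    have := hconj.smul hs
    rwa [smul_sub, smul_smul, ← Complex.ofReal_mul, one_div_mul_cancel h1, Complex.ofReal_one,
      one_smul, ← heq] at this
  · rw [heq, Matrix.trace_sub, rhoZero_trace, Matrix.trace_smul, Matrix.trace_sum]
    have : ∑ φ ∈ W, ((p φ : ℂ) • copies n (V *ᵥ φ)).trace = 1 := by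
      rw [← Complex.ofReal_one, ← hW.sum_eq_one, Complex.ofReal_sum]
      refine Finset.sum_congr rfl fun φ hφ => ?_
      rw [Matrix.trace_smul, copies_mulVec_trace n hV (hW.coherent φ hφ), smul_eq_mul, mul_one]
    rw [this, smul_eq_mul, mul_one, ← Complex.ofReal_one, ← Complex.ofReal_sub]
    congr 1
    field_simp
    ring

theorem residual_output (ht : 1 ≤ t) (hn : 1 ≤ n) (hε : 0 ≤ ε) (hW : IsWeightedSet W p)
    (hD : IsApproxDesign n ε W p) (hR : IsCloningMap ε R) (hV : V ∈ rotationGroup t) :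
    ((outcomeProb (bobResidual n ε W p V) : ℂ) •
        R (aliceState (bobResidual n ε W p V))).PosSemidef ∧
      ((outcomeProb (bobResidual n ε W p V) : ℂ) •
        R (aliceState (bobResidual n ε W p V))).trace = ((ε / (1 + ε) : ℝ) : ℂ) := by
  obtain ⟨hpos, htr⟩ := aliceUnnormalized_bobResidual ht hn hε hW hD hV
  have hprob : outcomeProb (bobResidual n ε W p V) = ε / (1 + ε) := by
    rw [outcomeProb, htr, Complex.ofReal_re]
  -- For `ε = 0` the residual outcome has probability zero; otherwise its state is symmetric and `R`
  -- sends it to a state.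
  rcases hε.eq_or_lt with h0 | h0
  · have hzero : outcomeProb (bobResidual n ε W p V) = 0 := by rw [hprob, ← h0, zero_div]
    rw [hzero, ← h0, Complex.ofReal_zero, zero_smul, zero_div, Complex.ofReal_zero,
      Matrix.trace_zero]
    exact ⟨Matrix.PosSemidef.zero, rfl⟩
  · have hq : 0 < ε / (1 + ε) := by positivity
    have hstate : IsSymmetricState (aliceState (bobResidual n ε W p V)) := by
      rw [aliceState, hprob]
      refine ⟨⟨hpos.smul ?_, ?_⟩, fun π x y => ?_⟩
      · rw [← Complex.ofReal_inv]
        exact_mod_cast (inv_pos.2 hq).le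
      · rw [Matrix.trace_smul, htr, smul_eq_mul, inv_mul_cancel₀ (Complex.ofReal_ne_zero.2 hq.ne')]
      · rw [Matrix.smul_apply, Matrix.smul_apply, aliceUnnormalized_comp_perm]
    obtain ⟨hp, ht1⟩ := hR.onSymmetric h0 _ hstate
    rw [hprob]
    refine ⟨hp.smul (by exact_mod_cast hq.le), ?_⟩
    rw [Matrix.trace_smul, ht1, smul_eq_mul, mul_one]

theorem state_copies_mulVec (hR : IsCloningMap ε R) (hV : V ∈ rotationGroup t)
    {φ : Fin (t + 1) → ℂ} (hφ : φ ∈ coherentStates t) : IsState (R (copies n (V *ᵥ φ))) := by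
  obtain ⟨ψ, hψ, h⟩ := exists_copies_mulVec_eq hV hφ n
  rw [h]
  exact hR.onCoherent ψ hψ

theorem aliceOutput_eq (hW : IsWeightedSet W p) (hV : V ∈ rotationGroup t) :
    aliceOutput ε W p R V = (∑ φ ∈ W, ((1 / (1 + ε) * p φ : ℝ) : ℂ) • R (copies n (V *ᵥ φ))) +
      (outcomeProb (bobResidual n ε W p V) : ℂ) • R (aliceState (bobResidual n ε W p V)) := by
  rw [aliceOutput]
  congr 1
  exact Finset.sum_congr rfl fun φ hφ => outcomeProb_smul_bobEffect hV (hW.coherent φ hφ)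

theorem coeff_nonneg (hε : 0 ≤ ε) (hW : IsWeightedSet W p) {φ : Fin (t + 1) → ℂ} (hφ : φ ∈ W) :
    (0 : ℂ) ≤ ((1 / (1 + ε) * p φ : ℝ) : ℂ) := by
  have := hW.nonneg φ hφ
  have h : 0 ≤ 1 / (1 + ε) * p φ := by positivity
  exact_mod_cast h

theorem aliceOutput_isState (ht : 1 ≤ t) (hn : 1 ≤ n) (hε : 0 ≤ ε) (hW : IsWeightedSet W p)
    (hD : IsApproxDesign n ε W p) (hR : IsCloningMap ε R) (hV : V ∈ rotationGroup t) :
    IsState (aliceOutput ε W p R V) := by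
  obtain ⟨hpos, htr⟩ := residual_output ht hn hε hW hD hR hV
  rw [aliceOutput_eq hW hV]
  constructor
  · refine Matrix.PosSemidef.add (Matrix.posSemidef_sum _ fun φ hφ => ?_) hpos
    exact (state_copies_mulVec hR hV (hW.coherent φ hφ)).1.smul (coeff_nonneg hε hW hφ)
  · rw [Matrix.trace_add, htr, Matrix.trace_sum]
    have : ∑ φ ∈ W, (((1 / (1 + ε) * p φ : ℝ) : ℂ) • R (copies n (V *ᵥ φ))).trace =
        ((1 / (1 + ε) : ℝ) : ℂ) := by
      have hs : ∑ φ ∈ W, ((1 / (1 + ε) * p φ : ℝ) : ℂ) = ((1 / (1 + ε) : ℝ) : ℂ) := by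
        rw [← Complex.ofReal_sum, ← Finset.mul_sum, hW.sum_eq_one, mul_one]
      rw [← hs]
      refine Finset.sum_congr rfl fun φ hφ => ?_
      rw [Matrix.trace_smul, (state_copies_mulVec hR hV (hW.coherent φ hφ)).2, smul_eq_mul, mul_one]
    rw [this, ← Complex.ofReal_add, ← Complex.ofReal_one]
    congr 1
    field_simp

/-- Every coherent state occurs in a decomposition of Alice's output. -/
theorem worstFidelity_mul_le (ht : 1 ≤ t) (hn : 1 ≤ n) (hε : 0 ≤ ε) (hW : IsWeightedSet W p)
    (hD : IsApproxDesign n ε W p) (hR : IsCloningMap ε R) (hV : V ∈ rotationGroup t)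
    {φ ψ : Fin (t + 1) → ℂ} (hφ : φ ∈ W) (hψ : ψ ∈ coherentStates t)
    (h : copies n (V *ᵥ φ) = copies n ψ) :
    1 / (1 + ε) * p φ * worstFidelity R ≤ (aliceOutput ε W p R V * copies m ψ).trace.re := by
  classical
  have hre : ∀ M : Op t m, M.PosSemidef → 0 ≤ (M * copies m ψ).trace.re := fun M hM =>
    (Complex.le_def.1 (trace_mul_ketbra_nonneg _ hM)).1
  have hc : 0 ≤ 1 / (1 + ε) * p φ := by
    have := hW.nonneg φ hφ
    positivity
  have hF : worstFidelity R ≤ (R (copies n ψ) * copies m ψ).trace.re := by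
    rw [copies.eq_1 m, ← fidelity_ketbra (hR.onCoherent ψ hψ).1 (copies_trace m hψ)]
    exact worstFidelity_le R hψ
  -- Keep only the term of `φ`; the others are positive and have nonnegative overlap with `ψ`.
  rw [aliceOutput_eq hW hV, ← Finset.add_sum_erase _ _ hφ, h, add_assoc, Matrix.add_mul,
    Matrix.trace_add, Complex.add_re, Matrix.smul_mul, Matrix.trace_smul, smul_eq_mul,
    Complex.re_ofReal_mul]
  refine (mul_le_mul_of_nonneg_left hF hc).trans (le_add_of_nonneg_right (hre _ ?_))
  refine Matrix.PosSemidef.add (Matrix.posSemidef_sum _ fun φ' hφ' => ?_)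
    (residual_output ht hn hε hW hD hR hV).1
  have hφ'' := Finset.mem_of_mem_erase hφ'
  exact (state_copies_mulVec hR hV (hW.coherent φ' hφ'')).1.smul (coeff_nonneg hε hW hφ'')

end Protocol

/-! ### The fidelity bound -/

theorem trace_mul_rhoZero_le {t m : ℕ} {σ : Op t m} (hσ : IsState σ) :
    (σ * rhoZero t m).trace.re ≤ 1 / ((m : ℝ) * t + 1) := by
  have hQ : (1 - spinProj t m)ᴴ = 1 - spinProj t m := by
    rw [Matrix.conjTranspose_sub, Matrix.conjTranspose_one, spinProj_conjTranspose]
  have hQQ : (1 - spinProj t m) * (1 - spinProj t m) = 1 - spinProj t m := by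
    rw [Matrix.mul_sub, Matrix.sub_mul, Matrix.sub_mul, spinProj_mul_self]
    simp
  have h0 : 0 ≤ ((1 - spinProj t m) * σ * (1 - spinProj t m)ᴴ).trace :=
    (hσ.1.mul_mul_conjTranspose_same _).trace_nonneg
  rw [hQ, Matrix.trace_mul_comm, ← Matrix.mul_assoc, hQQ, Matrix.trace_mul_comm, Matrix.mul_sub,
    Matrix.mul_one, Matrix.trace_sub, hσ.2] at h0
  have h1 := (Complex.le_def.1 h0).1
  rw [Complex.sub_re, Complex.one_re, Complex.zero_re] at h1
  have hc : (1 / ((m : ℂ) * t + 1)) = ((1 / ((m : ℝ) * t + 1) : ℝ) : ℂ) := by push_cast; rfl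
  rw [rhoZero, Matrix.mul_smul, Matrix.trace_smul, smul_eq_mul, hc, Complex.re_ofReal_mul]
  refine mul_le_of_le_one_right (by positivity) (by linarith)

/-- The bound on the worst case fidelity by the size of a weighted set. -/
theorem worstFidelity_le_card {t n m : ℕ} (ht : 1 ≤ t) (hn : 1 ≤ n) (hm : 1 ≤ m) {ε : ℝ}
    (hε : 0 ≤ ε) {W : Finset (Fin (t + 1) → ℂ)} {p : (Fin (t + 1) → ℂ) → ℝ}
    (hW : IsWeightedSet W p) (hD : IsApproxDesign n ε W p) {R : Op t n → Op t m}
    (hR : IsCloningMap ε R) (hNS : NoSignalling ε W p R) :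
    worstFidelity R ≤ (1 + ε) * ((W.card : ℝ) / ((m : ℝ) * t + 1)) := by
  obtain ⟨φ₀, hφ₀⟩ : W.Nonempty := by
    rw [Finset.nonempty_iff_ne_empty]
    rintro rfl
    simpa using hW.sum_eq_one
  obtain ⟨V₀, hV₀, -⟩ := hW.coherent φ₀ hφ₀
  set σ := aliceOutput ε W p R V₀
  have hσ : IsState σ := aliceOutput_isState ht hn hε hW hD hR hV₀
  -- The rotation `V` depends on `φ` and `ψ`, but no-signalling replaces its output by the fixed
  -- `σ`.
  have hpt : ∀ φ ∈ W, ∀ ψ ∈ coherentStates t,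
      1 / (1 + ε) * p φ * worstFidelity R ≤ (σ * copies m ψ).trace.re := by
    intro φ hφ ψ hψ
    obtain ⟨V, hV, h⟩ := exists_copies_mulVec_eq_copies (hW.coherent φ hφ) hψ n
    have hle := worstFidelity_mul_le ht hn hε hW hD hR hV hφ hψ h
    rwa [hNS V hV V₀ hV₀] at hle
  -- An exact design for `m` copies, unrelated to `W`, averages the targets `ψ` to `rhoZero t m`.
  obtain ⟨Θ, w, -, hG, hGρ, -⟩ := exists_design ht hm
  set G := gridSet t (m * t) Θ
  set g := gridWeight t (m * t) Θ w
  have hφ : ∀ φ ∈ W, 1 / (1 + ε) * p φ * worstFidelity R ≤ 1 / ((m : ℝ) * t + 1) := by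
    intro φ hφ
    calc 1 / (1 + ε) * p φ * worstFidelity R =
          ∑ ψ ∈ G, g ψ * (1 / (1 + ε) * p φ * worstFidelity R) := by
          rw [← Finset.sum_mul, hG.sum_eq_one, one_mul]
      _ ≤ ∑ ψ ∈ G, g ψ * (σ * copies m ψ).trace.re := Finset.sum_le_sum fun ψ hψ =>
          mul_le_mul_of_nonneg_left (hpt φ hφ ψ (hG.coherent ψ hψ)) (hG.nonneg ψ hψ)
      _ = (σ * rhoZero t m).trace.re := by
          rw [← hGρ, rhoW, Matrix.mul_sum, Matrix.trace_sum, Complex.re_sum]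
          refine Finset.sum_congr rfl fun ψ _ => ?_
          rw [Matrix.mul_smul, Matrix.trace_smul, smul_eq_mul, Complex.re_ofReal_mul]
      _ ≤ _ := trace_mul_rhoZero_le hσ
  have hsum := Finset.sum_le_sum hφ
  rw [← Finset.sum_mul, ← Finset.mul_sum, hW.sum_eq_one, Finset.sum_const, nsmul_eq_mul, mul_one,
    mul_one_div, one_div, inv_mul_le_iff₀ (by positivity)] at hsum
  exact hsum

end SpinCloning

theorem mainTheorem7 (t n : ℕ) (ht : 1 ≤ t) (hn : 1 ≤ n) :
    -- the bound by the size of a weighted set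
    (∀ (m : ℕ), 1 ≤ m → ∀ (ε : ℝ), 0 ≤ ε → ε < 1 →
      ∀ (W : Finset (Fin (t + 1) → ℂ)) (p : (Fin (t + 1) → ℂ) → ℝ),
        SpinCloning.IsWeightedSet W p → SpinCloning.IsApproxDesign n ε W p →
      ∀ R : SpinCloning.Op t n → SpinCloning.Op t m,
        SpinCloning.IsCloningMap ε R → SpinCloning.NoSignalling ε W p R →
        SpinCloning.worstFidelity R ≤
          ((1 + ε) / (1 - ε)) ^ 2 * ((W.card : ℝ) / ((m : ℝ) * (t : ℝ) + 1))) ∧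
    -- the quadrature construction and the bound that it gives
    (∃ (Θ : Finset ℝ) (w : ℝ → ℝ) (W : Finset (Fin (t + 1) → ℂ)) (p : (Fin (t + 1) → ℂ) → ℝ),
      SpinCloning.IsQuadrature (n * t) Θ w ∧
      W = SpinCloning.gridSet t (n * t) Θ ∧
      p = SpinCloning.gridWeight t (n * t) Θ w ∧
      SpinCloning.IsWeightedSet W p ∧
      SpinCloning.rhoW n W p = SpinCloning.rhoZero t n ∧
      (W.card : ℝ) ≤ ((n : ℝ) * (t : ℝ) + 1) ^ 2 / 2 ∧
      ∀ (m : ℕ), 1 ≤ m → ∀ R : SpinCloning.Op t n → SpinCloning.Op t m,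
        SpinCloning.IsCloningMap 0 R → SpinCloning.NoSignalling 0 W p R →
        SpinCloning.worstFidelity R ≤
          ((n : ℝ) * (t : ℝ) + 1) ^ 2 / (2 * ((m : ℝ) * (t : ℝ) + 1))) := by
  constructor
  · intro m hm ε hε hε1 W p hW hD R hR hNS
    -- The factor `1 + ε` suffices: `(1 - ε)² ≤ 1 + ε` on `[0, 1)`.
    refine (SpinCloning.worstFidelity_le_card ht hn hm hε hW hD hR hNS).trans
      (mul_le_mul_of_nonneg_right ?_ (by positivity))
    have h1 : 0 < 1 - ε := by linarith
    rw [div_pow, le_div_iff₀ (by positivity), pow_two (1 + ε)]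
    refine mul_le_mul_of_nonneg_left ?_ (by positivity)
    nlinarith
  · obtain ⟨Θ, w, hQ, hW, hρ, hcard⟩ := SpinCloning.exists_design ht hn
    refine ⟨Θ, w, _, _, hQ, rfl, rfl, hW, hρ, hcard, fun m hm R hR hNS => ?_⟩
    have hD : SpinCloning.IsApproxDesign n 0 (SpinCloning.gridSet t (n * t) Θ)
        (SpinCloning.gridWeight t (n * t) Θ w) := by
      rw [SpinCloning.IsApproxDesign, hρ]
      simp
    refine (SpinCloning.worstFidelity_le_card ht hn hm le_rfl hW hD hR hNS).trans ?_
    rw [add_zero, one_mul, ← div_div]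
    exact div_le_div_of_nonneg_right hcard (by positivity)
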